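/- Let $\Sigma$ be a finite alphabet partitioned into three (possibly empty) sets: calls $\Sigma_c$, returns $\Sigma_r$ and internals $\Sigma_i$. A visibly pushdown automaton over $(\Sigma_c,\Sigma_r,\Sigma_i)$ is a nondeterministic finite-state automaton with a stack, initially holding only a bottom symbol $Z_0$. Each move reads one letter. A call pushes one symbol different from $Z_0$. A return pops the top symbol if it is not $Z_0$, and reads $Z_0$ without removing it otherwise. An internal letter leaves the stack untouched. A word is accepted if it can be read completely ending in a final state, whatever the stack content. The languages recognized are the visibly pushdown languages (VPL) over the partition. A context-free grammar $G$ over $\Sigma$ with nonterminals $V_N$ is an operator grammar if no right-hand side has two adjacent nonterminals. For $X\in V_N$ let $\mathcal L(X)=\{a\in\Sigma \mid X\Rightarrow^* Ba\alpha,\ B\in V_N\cup\{\varepsilon\}\}$ and $\mathcal R(X)=\{a\in\Sigma\mid X\Rightarrow^*\alpha aB,\ B\in V_N\cup\{\varepsilon\}\}$, where $\alpha\in(V_N\cup\Sigma)^*$. For $a,b\in\Sigma$ put - $a\doteq b$ iff there is a rule $A\to\alpha aBb\beta$ with $B\in V_N\cup\{\varepsilon\}$; - $a\lessdot b$ iff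 there is a rule $A\to\alpha aD\beta$ with $D\in V_N$ and $b\in\mathcal L(D)$; - $a\gtrdot b$ iff there is a rule $A\to\alpha Db\beta$ with $D\in V_N$ and $a\in\mathcal R(D)$. The precedence matrix $OPM(G)$ stores in cell $(a,b)$ the set of relations holding between $a$ and $b$. $G$ is an operator precedence grammar (OPG) if it is an operator grammar and each cell of $OPM(G)$ has at most one element. An operator precedence language (OPL) is a language generated by an OPG. The partitioned matrix $M(\Sigma_c,\Sigma_r,\Sigma_i)$ has exactly one relation in each cell $(a,b)$: if $a\in\Sigma_c$, it is $\lessdot$ for $b\in\Sigma_c\cup\Sigma_i$ and $\doteq$ for $b\in\Sigma_r$; if $a\in\Sigma_r\cup\Sigma_i$, it is $\gtrdot$ for every $b$. A language is real-time if it is recognized, by final state, by a deterministic pushdown automaton that performs exactly $|x|$ moves on every input $x$. **Theorem.** 1. For every finite $\Sigma$ with a partition as above and every $L\subseteq\Sigma^*$, the following are equivalent: (i) $L$ is a VPL over the partition; (ii) $L$ is generated by an OPG $G$ with $OPM(G)=M(\Sigma_c,\Sigma_r,\Sigma_i)$; (iii) $L$ is generated by an OPG $G$ whose matrix is contained cell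 by cell in $M(\Sigma_c,\Sigma_r,\Sigma_i)$. (Grammars may contain rules that are unreachable from the axiom.) 2. Consequently every VPL (for any partition of its alphabet) is an OPL, and the inclusion is strict. Over the alphabet $\{a,b,c,d,e,f\}$, the language $\{a^mb^nc^nd^m\mid m,n\ge1\}\cup\{a^mb^ned^m\mid m,n\ge1\}$ is an OPL that is not real-time; and $\{b^nc^n\mid n\ge1\}\cup\{f^nd^n\mid n\ge1\}\cup\{e^n(fb)^n\mid n\ge1\}$ is an OPL that is real-time but is not a VPL for any partition of the alphabet. -/

import Mathlib

namespace StructLang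

universe u

/-! ### Partitioned alphabets and visibly pushdown automata -/

/-- The three classes of a pushdown alphabet. A partition of an alphabet `A` into (possibly empty)
call, return and internal alphabets is a function `A → Kind`. -/
inductive Kind where
  | call
  | ret
  | internal

/-- A (nondeterministic) visibly pushdown automaton over the partitioned alphabet `(A, kind)`. -/
structure VPA {A : Type u} (kind : A → Kind) where
  Q : Type
  Γ : Type
  finite_Q : Finite Q
  finite_Γ : Finite Γ
  /-- initial states -/
  I : Set Q
  /-- final states -/
  F : Set Q
  /-- bottom stack symbol -/
  Z₀ : Γ
  δcall : Set (Q × A × Q × Γ)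
  δret : Set (Q × A × Γ × Q)
  δint : Set (Q × A × Q)
  call_mem : ∀ q a q' D, (q, a, q', D) ∈ δcall → kind a = Kind.call ∧ D ≠ Z₀
  ret_mem : ∀ q a D q', (q, a, D, q') ∈ δret → kind a = Kind.ret
  int_mem : ∀ q a q', (q, a, q') ∈ δint → kind a = Kind.internal

namespace VPA

variable {A : Type u} {kind : A → Kind}

/-- One move. A configuration is (input still to be read, state, stack with its top first). -/
inductive Step (M : VPA kind) :
    List A × M.Q × List M.Γ → List A × M.Q × List M.Γ → Prop
  /-- a call pushes a symbol, which is never the bottom symbol -/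
  | call {q a q' D} (x : List A) (s : List M.Γ) (h : (q, a, q', D) ∈ M.δcall) :
      Step M (a :: x, q, s) (x, q', D :: s)
  /-- a matched return pops the top symbol -/
  | ret {q a D q'} (x : List A) (s : List M.Γ) (h : (q, a, D, q') ∈ M.δret) (hD : D ≠ M.Z₀) :
      Step M (a :: x, q, D :: s) (x, q', s)
  /-- an unmatched return sees the bottom symbol and leaves it in place -/
  | retBottom {q a q'} (x : List A) (s : List M.Γ) (h : (q, a, M.Z₀, q') ∈ M.δret) :
      Step M (a :: x, q, M.Z₀ :: s) (x, q', M.Z₀ :: s)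
  /-- an internal move does not touch the stack -/
  | internal {q a q'} (x : List A) (s : List M.Γ) (h : (q, a, q') ∈ M.δint) :
      Step M (a :: x, q, s) (x, q', s)

/-- Acceptance is by final state, whatever the stack content (unmatched calls are allowed). -/
def language (M : VPA kind) : Language A :=
  {w | ∃ q₀ ∈ M.I, ∃ q ∈ M.F, ∃ s : List M.Γ,
    Relation.ReflTransGen M.Step (w, q₀, [M.Z₀]) ([], q, s)}

end VPA

/-- `L` is a visibly pushdown language over the alphabet `A` partitioned by `kind`. -/
def IsVPLOver {A : Type u} (kind : A → Kind) (L : Language A) : Prop :=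
  ∃ M : VPA kind, M.language = L

/-- `L` is a visibly pushdown language, for some partition of its alphabet. -/
def IsVPL {A : Type u} (L : Language A) : Prop :=
  ∃ kind : A → Kind, IsVPLOver kind L

/-! ### Operator precedence grammars -/

/-- The three operator precedence relations. -/
inductive Prec where
  /-- `a ≐ b` -/
  | equal
  /-- `a ⋖ b`: `a` yields precedence to `b` -/
  | yields
  /-- `a ⋗ b`: `a` takes precedence over `b` -/
  | takes

/-- A matrix of sets of operator precedence relations. -/
abbrev PrecMatrix (A : Type u) : Type u := A → A → Set Prec

section Grammar

variable {A : Type u} (G : ContextFreeGrammar A)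

/-- Every right-hand side is free of adjacent nonterminals. -/
def IsOperatorGrammar : Prop :=
  ∀ r ∈ G.rules, ∀ (α β : List (Symbol A G.NT)) (B C : G.NT),
    r.output ≠ α ++ Symbol.nonterminal B :: Symbol.nonterminal C :: β

/-- The strings of length at most one over the nonterminals: `B ∈ V_N ∪ {ε}`. -/
def optNT : Option G.NT → List (Symbol A G.NT)
  | none => []
  | some B => [Symbol.nonterminal B]

/-- Left terminal set `{a | X ⇒* B a α, B ∈ V_N ∪ {ε}}`. -/
def leftTerminals (X : G.NT) : Set A :=
  {a | ∃ (B : Option G.NT) (α : List (Symbol A G.NT)),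
    G.Derives [Symbol.nonterminal X] (optNT G B ++ Symbol.terminal a :: α)}

/-- Right terminal set `{a | X ⇒* α a B, B ∈ V_N ∪ {ε}}`. -/
def rightTerminals (X : G.NT) : Set A :=
  {a | ∃ (B : Option G.NT) (α : List (Symbol A G.NT)),
    G.Derives [Symbol.nonterminal X] (α ++ Symbol.terminal a :: optNT G B)}

/-- `Holds G ∘ a b` says that the precedence relation `a ∘ b` holds in the grammar `G`. -/
def Holds : Prec → A → A → Prop
  | Prec.equal, a, b => ∃ r ∈ G.rules, ∃ (α β : List (Symbol A G.NT)) (B : Option G.NT),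
      r.output = α ++ Symbol.terminal a :: (optNT G B ++ Symbol.terminal b :: β)
  | Prec.yields, a, b => ∃ r ∈ G.rules, ∃ (α β : List (Symbol A G.NT)) (D : G.NT),
      r.output = α ++ Symbol.terminal a :: Symbol.nonterminal D :: β ∧ b ∈ leftTerminals G D
  | Prec.takes, a, b => ∃ r ∈ G.rules, ∃ (α β : List (Symbol A G.NT)) (D : G.NT),
      r.output = α ++ Symbol.nonterminal D :: Symbol.terminal b :: β ∧ a ∈ rightTerminals G D

/-- The operator precedence matrix of `G`. -/
def opm : PrecMatrix A := fun a b => {p | Holds G p a b}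

/-- `G` is an operator precedence grammar: an operator grammar with a conflict-free matrix. -/
def IsOPG : Prop :=
  IsOperatorGrammar G ∧ ∀ a b, (opm G a b).Subsingleton

end Grammar

/-- Operator precedence languages. -/
def IsOPL {A : Type u} (L : Language A) : Prop :=
  ∃ G : ContextFreeGrammar A, IsOPG G ∧ G.language = L

/-- The relation in each block of a partitioned matrix:
calls yield precedence to calls and internals and are equal in precedence to returns;
returns and internals take precedence over everything. -/
def Kind.prec : Kind → Kind → Prec
  | Kind.call, Kind.call => Prec.yields
  | Kind.call, Kind.ret => Prec.equal
  | Kind.call, Kind.internal => Prec.yields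
  | Kind.ret, _ => Prec.takes
  | Kind.internal, _ => Prec.takes

/-- The partitioned matrix of a partitioned alphabet. -/
def partitionedMatrix {A : Type u} (kind : A → Kind) : PrecMatrix A :=
  fun a b => {(kind a).prec (kind b)}

/-! ### Pushdown automata and real-time languages -/

/-- A pushdown automaton with input alphabet `A`; the input component `none` of a transition
stands for `ε`. -/
structure PDA (A : Type u) where
  Q : Type
  Γ : Type
  finite_Q : Finite Q
  finite_Γ : Finite Γ
  δ : Set (Q × Γ × Option A × Q × List Γ)
  finite_δ : δ.Finite
  /-- initial states -/
  I : Set Q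
  /-- initial stack symbol -/
  Z₀ : Γ
  /-- final states -/
  F : Set Q

namespace PDA

variable {A : Type u}

/-- One move. A configuration is (input still to be read, state, stack with its top first). -/
inductive Step (M : PDA A) :
    List A × M.Q × List M.Γ → List A × M.Q × List M.Γ → Prop
  | read {q C a q' α} (x : List A) (s : List M.Γ) (h : (q, C, some a, q', α) ∈ M.δ) :
      Step M (a :: x, q, C :: s) (x, q', α ++ s)
  | eps {q C q' α} (x : List A) (s : List M.Γ) (h : (q, C, none, q', α) ∈ M.δ) :
      Step M (x, q, C :: s) (x, q', α ++ s)

/-- Computations of exactly `n` moves. -/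
inductive Steps (M : PDA A) :
    ℕ → List A × M.Q × List M.Γ → List A × M.Q × List M.Γ → Prop
  | zero (c) : Steps M 0 c c
  | succ {n c₁ c₂ c₃} (h : Steps M n c₁ c₂) (h' : M.Step c₂ c₃) : Steps M (n + 1) c₁ c₃

/-- Acceptance is by final state, after the whole input has been read. -/
def language (M : PDA A) : Language A :=
  {w | ∃ q₀ ∈ M.I, ∃ q ∈ M.F, ∃ (s : List M.Γ) (n : ℕ), M.Steps n (w, q₀, [M.Z₀]) ([], q, s)}

/-- Determinism: one initial state, a (partial) transition function, and no pair of state and top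
symbol with both an `ε`-move and a reading move. -/
def IsDeterministic (M : PDA A) : Prop :=
  (∃ q₀, M.I = {q₀}) ∧
  (∀ q C o q₁ α₁ q₂ α₂, (q, C, o, q₁, α₁) ∈ M.δ → (q, C, o, q₂, α₂) ∈ M.δ →
    q₁ = q₂ ∧ α₁ = α₂) ∧
  (∀ q C a q₁ α₁ q₂ α₂, (q, C, some a, q₁, α₁) ∈ M.δ → (q, C, none, q₂, α₂) ∉ M.δ)

/-- On every input `x` the automaton performs exactly `|x|` moves. -/
def IsRealTime (M : PDA A) : Prop :=
  ∀ x : List A, ∀ q₀ ∈ M.I,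
    (∃ c, M.Steps x.length (x, q₀, [M.Z₀]) c) ∧
    ∀ n c, M.Steps n (x, q₀, [M.Z₀]) c → n ≤ x.length

end PDA

/-- `L` is a real-time language: some deterministic pushdown automaton recognizes it performing
exactly `|x|` moves on every input `x`. -/
def IsRealTimeLanguage {A : Type u} (L : Language A) : Prop :=
  ∃ M : PDA A, M.IsDeterministic ∧ M.IsRealTime ∧ M.language = L

/-! ### Two languages -/

/-- The letters of the two languages below. -/
inductive Letter where
  | a
  | b
  | c
  | d
  | e
  | f

open Letter in
/-- `{aᵐ bⁿ cⁿ dᵐ | m, n ≥ 1} ∪ {aᵐ bⁿ e dᵐ | m, n ≥ 1}` -/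
def langBlocks : Language Letter :=
  {w | ∃ m n : ℕ, 1 ≤ m ∧ 1 ≤ n ∧
      (w = List.replicate m a ++ List.replicate n b ++ List.replicate n c ++ List.replicate m d ∨
        w = List.replicate m a ++ List.replicate n b ++ [e] ++ List.replicate m d)}

open Letter in
/-- `{bⁿ cⁿ | n ≥ 1} ∪ {fⁿ dⁿ | n ≥ 1} ∪ {eⁿ (f b)ⁿ | n ≥ 1}` -/
def langPairs : Language Letter :=
  {w | ∃ n : ℕ, 1 ≤ n ∧
      (w = List.replicate n b ++ List.replicate n c ∨
        w = List.replicate n f ++ List.replicate n d ∨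
        w = List.replicate n e ++ (List.replicate n [f, b]).flatten)}

end StructLang

open StructLang

/-!
Both directions of the equivalence rest on the fact that the partitioned matrix dictates the shape
of the rules. A right-hand side in operator form whose relations lie in that matrix is, up to
nonterminals that derive at most the empty word, one of `X`, `X a`, `X c Y` and `X c Y r`, where `X`
and `Y` are optional nonterminals, `c` is a call, `r` a return and `a` an internal letter or an
unmatched return; only words without pending calls precede a terminal, and only words without
unmatched returns follow a call.

From an automaton `M` to a grammar (`vpaGrammar`): a nonterminal `body β p q` derives the words that
lead from `p` to `q` without pending calls, and `tail` collects the words that contain pending calls.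
Bounds for the terminal sets, checked rule by rule (`opm_subset_of_respects`), put the precedence
matrix inside the partitioned one, and unreachable rules make the two equal (`vpaGrammar_opm_eq`).
The language is computed by induction on derivations (`VPARule.sound`) and on runs
(`RunInvariant.step`).

From a grammar to an automaton (`parser`): the automaton keeps in its state a nonterminal deriving
the word read since the last open call, and guesses at each call whether it will be matched; if not,
it guesses a nonterminal that the rest of the input has to derive. Its moves are defined through
derivability, so that renaming and empty rules need no separate treatment. Soundness is an invariant
of runs (`ParseInvariant`), completeness an induction on derivation trees (`runs_of_rule`).

A real-time automaton for `langBlocks` would have to reach pairwise different configurations on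
`aᵐ bⁿ` for fixed `m`, since the continuations `cⁿ dᵐ` differ. So the stack grows without bound, and
after the moment at which it is lowest, its upper part is determined by a state and a stack symbol
(`PDA.exists_lowest`). Two values of `m` share this pair, and then a large upper part hides the rest
of the stack while `e dᵐ` is read. The language `langPairs` is recognized by a one-counter real-time
automaton, but a visibly pushdown automaton would need `b` and `f` to be calls because of `bⁿ cⁿ`
and `fⁿ dⁿ`, and then it cannot look at its stack while reading `(f b)ⁿ`.
-/

namespace StructLang

/-! ### Derivations of terminal words -/

section Words

universe u

variable {A : Type u} {N : Type}

/-- `Factors P s w`: the word `w` is a concatenation of words, one for each symbol of `s`, where a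
terminal contributes itself and a nonterminal `X` contributes some `u` with `P X u`. -/
inductive Factors (P : N → List A → Prop) : List (Symbol A N) → List A → Prop
  | nil : Factors P [] []
  | terminal {s w} (a : A) (h : Factors P s w) : Factors P (Symbol.terminal a :: s) (a :: w)
  | nonterminal {s X u v} (hu : P X u) (hv : Factors P s v) :
      Factors P (Symbol.nonterminal X :: s) (u ++ v)

namespace Factors

variable {P P' : N → List A → Prop} {s t : List (Symbol A N)} {w v : List A}

theorem mono (hP : ∀ X u, P X u → P' X u) (h : Factors P s w) : Factors P' s w := by
  induction h with
  | nil => exact nil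
  | terminal a _ ih => exact ih.terminal a
  | nonterminal hu _ ih => exact ih.nonterminal (hP _ _ hu)

theorem exists_append (h : Factors P (s ++ t) w) :
    ∃ u v, w = u ++ v ∧ Factors P s u ∧ Factors P t v := by
  induction s generalizing w with
  | nil => exact ⟨[], w, rfl, nil, h⟩
  | cons x s ih =>
    cases h with
    | terminal a h =>
      obtain ⟨u, v, rfl, hu, hv⟩ := ih h
      exact ⟨a :: u, v, rfl, hu.terminal a, hv⟩
    | nonterminal hX h =>
      obtain ⟨u, v, rfl, hu, hv⟩ := ih h
      exact ⟨_ ++ u, v, by simp, hu.nonterminal hX, hv⟩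

theorem singleton {X : N} (h : P X w) : Factors P [Symbol.nonterminal X] w := by
  simpa using nil.nonterminal h

@[simp]
theorem nil_iff : Factors P [] w ↔ w = [] :=
  ⟨fun h => by cases h; rfl, fun h => h ▸ nil⟩

@[simp]
theorem terminal_iff {a : A} :
    Factors P (Symbol.terminal a :: s) w ↔ ∃ v, w = a :: v ∧ Factors P s v :=
  ⟨fun h => by cases h with | terminal _ h => exact ⟨_, rfl, h⟩,
    fun ⟨_, hw, h⟩ => hw ▸ h.terminal a⟩

@[simp]
theorem nonterminal_iff {X : N} :
    Factors P (Symbol.nonterminal X :: s) w ↔ ∃ u v, w = u ++ v ∧ P X u ∧ Factors P s v :=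
  ⟨fun h => by cases h with | nonterminal hu hv => exact ⟨_, _, rfl, hu, hv⟩,
    fun ⟨_, _, hw, hu, hv⟩ => hw ▸ hv.nonterminal hu⟩

end Factors

variable (G : ContextFreeGrammar A)

/-- `GenWord G X w`: the terminal word `w` is derivable from the nonterminal `X`. -/
def GenWord (X : G.NT) (w : List A) : Prop :=
  G.Derives [Symbol.nonterminal X] (w.map Symbol.terminal)

variable {G}

theorem derives_append {s s' t t' : List (Symbol A G.NT)} (h : G.Derives s s')
    (h' : G.Derives t t') : G.Derives (s ++ t) (s' ++ t') :=
  (h.append_right t).trans (h'.append_left s')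

theorem derives_cons {s s' : List (Symbol A G.NT)} (x : Symbol A G.NT) (h : G.Derives s s') :
    G.Derives (x :: s) (x :: s') :=
  h.append_left [x]

theorem derives_of_rule {r : ContextFreeRule A G.NT} (hr : r ∈ G.rules) :
    G.Derives [Symbol.nonterminal r.input] r.output :=
  Relation.ReflTransGen.single ⟨r, hr, ContextFreeRule.Rewrites.input_output⟩

theorem Factors.derives {s : List (Symbol A G.NT)} {w : List A} (h : Factors (GenWord G) s w) :
    G.Derives s (w.map Symbol.terminal) := by
  induction h with
  | nil => exact Relation.ReflTransGen.refl
  | terminal a _ ih => exact derives_cons _ ih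
  | nonterminal hu _ ih => rw [List.map_append]; exact derives_append hu ih

theorem genWord_of_rule {r : ContextFreeRule A G.NT} (hr : r ∈ G.rules) {w : List A}
    (h : Factors (GenWord G) r.output w) : GenWord G r.input w :=
  (derives_of_rule hr).trans h.derives

theorem Factors.of_produces {P : G.NT → List A → Prop}
    (hP : ∀ r ∈ G.rules, ∀ u, Factors P r.output u → P r.input u)
    {s t : List (Symbol A G.NT)} {w : List A} (h : G.Produces s t) (ht : Factors P t w) :
    Factors P s w := by
  obtain ⟨r, hr, h⟩ := h
  induction h generalizing w with
  | head s =>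
    obtain ⟨u, v, rfl, hu, hv⟩ := ht.exists_append
    exact hv.nonterminal (hP r hr u hu)
  | cons x _ ih =>
    cases ht with
    | terminal a h => exact (ih h).terminal a
    | nonterminal hX h => exact (ih h).nonterminal hX

theorem Factors.map_terminal {P : N → List A → Prop} (w : List A) :
    Factors P (w.map Symbol.terminal) w := by
  induction w with
  | nil => exact nil
  | cons a w ih => exact ih.terminal a

theorem Factors.of_derives {P : G.NT → List A → Prop}
    (hP : ∀ r ∈ G.rules, ∀ u, Factors P r.output u → P r.input u)
    {s : List (Symbol A G.NT)} {w : List A} (h : G.Derives s (w.map Symbol.terminal)) :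
    Factors P s w := by
  induction h using Relation.ReflTransGen.head_induction_on with
  | refl => exact map_terminal w
  | head h _ ih => exact ih.of_produces hP h

/-- Induction on derivation trees: a property of pairs (nonterminal, word) that passes from the
children of a node to the node holds for every derivable word. -/
theorem GenWord.induction {P : G.NT → List A → Prop}
    (hP : ∀ r ∈ G.rules, ∀ u, Factors (fun X v => GenWord G X v ∧ P X v) r.output u → P r.input u)
    {X : G.NT} {w : List A} (h : GenWord G X w) : P X w := by
  have := Factors.of_derives (P := fun X v => GenWord G X v ∧ P X v) (fun r hr u hu =>
    ⟨genWord_of_rule hr (hu.mono fun _ _ h => h.1), hP r hr u hu⟩) h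
  obtain ⟨u, v, rfl, hu, hv⟩ := Factors.nonterminal_iff.1 this
  obtain rfl := Factors.nil_iff.1 hv
  simpa using hu.2

end Words

/-! ### Bounding a precedence matrix rule by rule -/

section Bounds

universe u

variable {A : Type u} {N : Type}

/-- `LeadIn ℓ K s`: if `ℓ X` bounds the left terminals of each nonterminal `X`, then `K` contains
every terminal that can come first, or second after a nonterminal, in a string derived from `s`. -/
def LeadIn (ℓ : N → Set A) (K : Set A) : List (Symbol A N) → Prop
  | [] => True
  | [Symbol.nonterminal X] => ℓ X ⊆ K
  | Symbol.terminal a :: _ => a ∈ K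
  | Symbol.nonterminal X :: Symbol.terminal a :: _ => ℓ X ⊆ K ∧ a ∈ K
  | Symbol.nonterminal _ :: Symbol.nonterminal _ :: _ => False

theorem LeadIn.mono {ℓ : N → Set A} {K K' : Set A} (hK : K ⊆ K') {s : List (Symbol A N)}
    (h : LeadIn ℓ K s) : LeadIn ℓ K' s := by
  match s, h with
  | [], _ => trivial
  | [Symbol.nonterminal X], h => exact subset_trans h hK
  | Symbol.terminal a :: _, h => exact hK h
  | Symbol.nonterminal X :: Symbol.terminal a :: _, h => exact ⟨subset_trans h.1 hK, hK h.2⟩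

theorem LeadIn.rewrites {ℓ : N → Set A} {K : Set A} {r : ContextFreeRule A N}
    (hr : LeadIn ℓ (ℓ r.input) r.output) {s t : List (Symbol A N)} (hst : r.Rewrites s t)
    (hs : LeadIn ℓ K s) : LeadIn ℓ K t := by
  cases hst with
  | head s =>
    match s, hs with
    | [], hs => rw [List.append_nil]; exact hr.mono hs
    | Symbol.terminal a :: s, hs =>
      have hr' := hr.mono hs.1
      generalize r.output = o at hr'
      match o, hr' with
      | [], _ => exact hs.2
      | [Symbol.nonterminal X], h => exact ⟨h, hs.2⟩
      | Symbol.terminal a :: _, h => exact h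
      | Symbol.nonterminal X :: Symbol.terminal a :: _, h => exact h
  | cons x h =>
    match x, h, hs with
    | Symbol.terminal a, _, hs => exact hs
    | Symbol.nonterminal X, .head [], hs => exact hs.elim
    | Symbol.nonterminal X, .head (_ :: _), hs => exact hs.elim
    | Symbol.nonterminal X, .cons (Symbol.terminal a) h, hs => exact hs
    | Symbol.nonterminal X, .cons (Symbol.nonterminal a) h, hs => exact hs.elim

variable {G : ContextFreeGrammar A}

theorem LeadIn.derives {ℓ : G.NT → Set A} (hℓ : ∀ r ∈ G.rules, LeadIn ℓ (ℓ r.input) r.output)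
    {K : Set A} {s t : List (Symbol A G.NT)} (hst : G.Derives s t) (hs : LeadIn ℓ K s) :
    LeadIn ℓ K t := by
  induction hst with
  | refl => exact hs
  | tail _ h ih => obtain ⟨r, hr, h⟩ := h; exact LeadIn.rewrites (hℓ r hr) h ih

theorem leftTerminals_subset {ℓ : G.NT → Set A}
    (hℓ : ∀ r ∈ G.rules, LeadIn ℓ (ℓ r.input) r.output) (X : G.NT) :
    leftTerminals G X ⊆ ℓ X := by
  rintro a ⟨B, α, h⟩
  have := LeadIn.derives hℓ (K := ℓ X) h subset_rfl
  cases B with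
  | none => exact this
  | some B => exact this.2

theorem rightTerminals_subset {ρ : G.NT → Set A}
    (hρ : ∀ r ∈ G.rules, LeadIn ρ (ρ r.input) r.output.reverse) (X : G.NT) :
    rightTerminals G X ⊆ ρ X := by
  rintro a ⟨B, α, h⟩
  have h' := h.reverse
  refine leftTerminals_subset (G := G.reverse) (ℓ := ρ) ?_ X ⟨B, α.reverse, ?_⟩
  · intro r hr
    obtain ⟨r, hr', rfl⟩ := Finset.mem_map.1 hr
    exact hρ r hr'
  · cases B <;>
    · simp [optNT, -ContextFreeGrammar.derives_reverse_comm] at h' ⊢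
      exact h'

/-- The precedence relations that a terminal `a` enters through the string following it all belong
to `M`. -/
def TerminalRespects (M : PrecMatrix A) (ℓ : N → Set A) (a : A) : List (Symbol A N) → Prop
  | [] => True
  | Symbol.terminal b :: _ => Prec.equal ∈ M a b
  | [Symbol.nonterminal X] => ∀ b ∈ ℓ X, Prec.yields ∈ M a b
  | Symbol.nonterminal X :: Symbol.terminal b :: _ =>
      (∀ b ∈ ℓ X, Prec.yields ∈ M a b) ∧ Prec.equal ∈ M a b
  | Symbol.nonterminal _ :: Symbol.nonterminal _ :: _ => False

/-- The precedence relations that a nonterminal with right terminals `R` enters through the string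
following it all belong to `M`; that string does not begin with a nonterminal. -/
def NonterminalRespects (M : PrecMatrix A) (R : Set A) : List (Symbol A N) → Prop
  | [] => True
  | Symbol.terminal b :: _ => ∀ a ∈ R, Prec.takes ∈ M a b
  | Symbol.nonterminal _ :: _ => False

/-- The right-hand side `s` is in operator form and, if `ℓ` and `ρ` bound the left and right terminal
sets, all precedence relations read off it belong to `M`. -/
def Respects (M : PrecMatrix A) (ℓ ρ : N → Set A) : List (Symbol A N) → Prop
  | [] => True
  | Symbol.terminal a :: s => TerminalRespects M ℓ a s ∧ Respects M ℓ ρ s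
  | Symbol.nonterminal X :: s => NonterminalRespects M (ρ X) s ∧ Respects M ℓ ρ s

theorem Respects.of_append {M : PrecMatrix A} {ℓ ρ : N → Set A} {s t : List (Symbol A N)}
    (h : Respects M ℓ ρ (s ++ t)) : Respects M ℓ ρ t := by
  induction s with
  | nil => exact h
  | cons x s ih => cases x <;> exact ih h.2

/-- A matrix `M` bounds the precedence matrix of a grammar as soon as `M`, together with bounds `ℓ`
and `ρ` for the terminal sets, is consistent with every single rule. -/
theorem opm_subset_of_respects {M : PrecMatrix A} {ℓ ρ : G.NT → Set A}
    (hℓ : ∀ r ∈ G.rules, LeadIn ℓ (ℓ r.input) r.output)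
    (hρ : ∀ r ∈ G.rules, LeadIn ρ (ρ r.input) r.output.reverse)
    (hM : ∀ r ∈ G.rules, Respects M ℓ ρ r.output) :
    IsOperatorGrammar G ∧ ∀ a b, opm G a b ⊆ M a b := by
  refine ⟨fun r hr α β B C h => ?_, fun a b p hp => ?_⟩
  · exact (h ▸ hM r hr).of_append.1
  · cases p with
    | equal =>
      obtain ⟨r, hr, α, β, B, h⟩ := hp
      have := (h ▸ hM r hr).of_append.1
      cases B with
      | none => exact this
      | some B => exact this.2
    | yields =>
      obtain ⟨r, hr, α, β, D, h, hb⟩ := hp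
      have := (h ▸ hM r hr).of_append.1
      match β, this with
      | [], h => exact h b (leftTerminals_subset hℓ D hb)
      | Symbol.terminal _ :: _, h => exact h.1 b (leftTerminals_subset hℓ D hb)
    | takes =>
      obtain ⟨r, hr, α, β, D, h, ha⟩ := hp
      exact (h ▸ hM r hr).of_append.1 a (rightTerminals_subset hρ D ha)

end Bounds

/-! ### From a visibly pushdown automaton to an operator precedence grammar -/

section OfVPA

universe u

variable {A : Type u} {kind : A → Kind}

theorem equal_mem_partitionedMatrix {a b : A} (ha : kind a = Kind.call) (hb : kind b = Kind.ret) :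
    Prec.equal ∈ partitionedMatrix kind a b := by
  simp [partitionedMatrix, ha, hb, Kind.prec]

theorem yields_mem_partitionedMatrix {a b : A} (ha : kind a = Kind.call) (hb : kind b ≠ Kind.ret) :
    Prec.yields ∈ partitionedMatrix kind a b := by
  cases h : kind b <;> simp_all [partitionedMatrix, Kind.prec]

theorem takes_mem_partitionedMatrix {a b : A} (ha : kind a ≠ Kind.call) :
    Prec.takes ∈ partitionedMatrix kind a b := by
  cases h : kind a <;> simp_all [partitionedMatrix, Kind.prec]

/-- Nonterminals of the grammar of a visibly pushdown automaton with state set `Q`. -/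
inductive VPANT (Q : Type) where
  /-- The words leading from state `p` to state `q` with all calls matched; unmatched returns may
  occur exactly if `bottom` is true. -/
  | body (bottom : Bool) (p q : Q)
  /-- The words without unmatched returns leading from state `p` to a final state. -/
  | tail (p : Q)
  /-- The axiom. -/
  | start
  /-- Any single letter of kind `k`; it occurs only below `filler`. -/
  | letter (k : Kind)
  /-- An unreachable nonterminal, whose rules produce every relation of the partitioned matrix. -/
  | filler

open VPANT in
/-- The rules of the grammar of a visibly pushdown automaton. -/
inductive VPARule (M : VPA kind) : VPANT M.Q → List (Symbol A (VPANT M.Q)) → Prop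
  | empty (β p) : VPARule M (body β p p) []
  | internal (β p) {q a q'} (h : (q, a, q') ∈ M.δint) :
      VPARule M (body β p q') [.nonterminal (body β p q), .terminal a]
  | matched (β p) {q a q' D q'' b q₁} (h : (q, a, q', D) ∈ M.δcall)
      (h' : (q'', b, D, q₁) ∈ M.δret) :
      VPARule M (body β p q₁) [.nonterminal (body β p q), .terminal a,
        .nonterminal (body false q' q''), .terminal b]
  | retBottom (p) {q a q'} (h : (q, a, M.Z₀, q') ∈ M.δret) :
      VPARule M (body true p q') [.nonterminal (body true p q), .terminal a]
  | tailEnd (p) {q} (h : q ∈ M.F) : VPARule M (tail p) [.nonterminal (body false p q)]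
  | tailCall (p) {q a q' D} (h : (q, a, q', D) ∈ M.δcall) :
      VPARule M (tail p)
        [.nonterminal (body false p q), .terminal a, .nonterminal (tail q')]
  | startEnd {p q} (hp : p ∈ M.I) (h : q ∈ M.F) :
      VPARule M start [.nonterminal (body true p q)]
  | startCall {p q a q' D} (hp : p ∈ M.I) (h : (q, a, q', D) ∈ M.δcall) :
      VPARule M start [.nonterminal (body true p q), .terminal a, .nonterminal (tail q')]
  | letter (a) : VPARule M (letter (kind a)) [.terminal a]
  | equal {a b} (ha : kind a = Kind.call) (hb : kind b = Kind.ret) :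
      VPARule M filler [.terminal a, .terminal b]
  | yields {a b} (ha : kind a = Kind.call) (hb : kind b ≠ Kind.ret) :
      VPARule M filler [.terminal a, .nonterminal (letter (kind b))]
  | takes {a b} (ha : kind a ≠ Kind.call) :
      VPARule M filler [.nonterminal (letter (kind a)), .terminal b]

instance {Q : Type} [Finite Q] : Finite (VPANT Q) := by
  have hK : Finite Kind := Finite.of_surjective
    (fun n : Fin 3 => match n with | 0 => Kind.call | 1 => Kind.ret | 2 => Kind.internal)
    (by rintro (_ | _ | _); exacts [⟨0, rfl⟩, ⟨1, rfl⟩, ⟨2, rfl⟩])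
  refine Finite.of_surjective (α := Bool × Q × Q ⊕ Q ⊕ Kind ⊕ Bool) (fun x => match x with
    | .inl (β, p, q) => VPANT.body β p q
    | .inr (.inl p) => VPANT.tail p
    | .inr (.inr (.inl k)) => VPANT.letter k
    | .inr (.inr (.inr true)) => VPANT.start
    | .inr (.inr (.inr false)) => VPANT.filler) ?_
  rintro (⟨β, p, q⟩ | p | _ | k | _)
  exacts [⟨.inl (β, p, q), rfl⟩, ⟨.inr (.inl p), rfl⟩, ⟨.inr (.inr (.inr true)), rfl⟩,
    ⟨.inr (.inr (.inl k)), rfl⟩, ⟨.inr (.inr (.inr false)), rfl⟩]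

theorem finite_symbol {N : Type} [Finite A] [Finite N] : Finite (Symbol A N) :=
  Finite.of_surjective (Sum.elim Symbol.terminal Symbol.nonterminal : A ⊕ N → Symbol A N)
    (by rintro (a | X); exacts [⟨.inl a, rfl⟩, ⟨.inr X, rfl⟩])

theorem finite_vpaRule [Finite A] (M : VPA kind) :
    {r : ContextFreeRule A (VPANT M.Q) | VPARule M r.input r.output}.Finite := by
  have := M.finite_Q
  have := finite_symbol (A := A) (N := VPANT M.Q)
  have hinj : Function.Injective
      fun r : ContextFreeRule A (VPANT M.Q) => (r.input, r.output) := by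
    rintro ⟨_, _⟩ ⟨_, _⟩ h
    simpa using h
  refine Set.Finite.subset (Set.Finite.preimage hinj.injOn
    ((Set.finite_univ (α := VPANT M.Q)).prod
      (List.finite_length_le (Symbol A (VPANT M.Q)) 4))) ?_
  rintro ⟨X, s⟩ h
  refine ⟨trivial, ?_⟩
  change VPARule M X s at h
  change s.length ≤ 4
  cases h <;> simp

namespace VPANT

variable (kind) {Q : Type}

/-- A bound for the left terminals in the grammar of a visibly pushdown automaton. -/
def left : VPANT Q → Set A
  | body true _ _ => Set.univ
  | body false _ _ => {a | kind a ≠ Kind.ret}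
  | tail _ => {a | kind a ≠ Kind.ret}
  | start => Set.univ
  | letter k => {a | kind a = k}
  | filler => Set.univ

/-- A bound for the right terminals in the grammar of a visibly pushdown automaton. -/
def right : VPANT Q → Set A
  | body _ _ _ => {a | kind a ≠ Kind.call}
  | tail _ => Set.univ
  | start => Set.univ
  | letter k => {a | kind a = k}
  | filler => Set.univ

end VPANT

variable {M : VPA kind}

theorem leadIn_vpaRule {X : VPANT M.Q} {s : List (Symbol A (VPANT M.Q))} (h : VPARule M X s) :
    LeadIn (VPANT.left kind) (VPANT.left kind X) s := by
  cases h with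
  | empty => trivial
  | internal β p h =>
    have := M.int_mem _ _ _ h
    cases β <;> simp [LeadIn, VPANT.left, this]
  | matched β p h h' =>
    have := (M.call_mem _ _ _ _ h).1
    cases β <;> simp [LeadIn, VPANT.left, this]
  | tailCall _ h =>
    have := (M.call_mem _ _ _ _ h).1
    simp [LeadIn, VPANT.left, this]
  | _ => simp [LeadIn, VPANT.left]

theorem leadIn_reverse_vpaRule {X : VPANT M.Q} {s : List (Symbol A (VPANT M.Q))}
    (h : VPARule M X s) : LeadIn (VPANT.right kind) (VPANT.right kind X) s.reverse := by
  cases h with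
  | empty => trivial
  | internal β p h => simp [LeadIn, VPANT.right, M.int_mem _ _ _ h]
  | matched β p h h' => simp [LeadIn, VPANT.right, M.ret_mem _ _ _ _ h']
  | retBottom β h => simp [LeadIn, VPANT.right, M.ret_mem _ _ _ _ h]
  | _ => simp [LeadIn, VPANT.right]

theorem respects_vpaRule {X : VPANT M.Q} {s : List (Symbol A (VPANT M.Q))} (h : VPARule M X s) :
    Respects (partitionedMatrix kind) (VPANT.left kind) (VPANT.right kind) s := by
  have htakes : ∀ b, ∀ a ∈ {a : A | kind a ≠ Kind.call}, Prec.takes ∈ partitionedMatrix kind a b :=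
    fun b a h => takes_mem_partitionedMatrix h
  cases h with
  | matched β p h h' =>
    have ha := (M.call_mem _ _ _ _ h).1
    have hb := M.ret_mem _ _ _ _ h'
    exact ⟨htakes _, ⟨fun b hb => yields_mem_partitionedMatrix ha hb,
      equal_mem_partitionedMatrix ha hb⟩, htakes _, trivial, trivial⟩
  | tailCall _ h =>
    have ha := (M.call_mem _ _ _ _ h).1
    exact ⟨htakes _, fun b hb => yields_mem_partitionedMatrix ha hb, trivial, trivial⟩
  | startCall _ h =>
    have ha := (M.call_mem _ _ _ _ h).1
    exact ⟨htakes _, fun b hb => yields_mem_partitionedMatrix ha hb, trivial, trivial⟩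
  | internal => exact ⟨htakes _, trivial, trivial⟩
  | retBottom => exact ⟨htakes _, trivial, trivial⟩
  | equal ha hb => exact ⟨equal_mem_partitionedMatrix ha hb, trivial, trivial⟩
  | yields ha hb =>
    exact ⟨fun c hc => yields_mem_partitionedMatrix ha (hc.trans_ne hb), trivial, trivial⟩
  | takes ha =>
    exact ⟨fun c hc => takes_mem_partitionedMatrix (hc.trans_ne ha), trivial, trivial⟩
  | _ => simp [Respects, TerminalRespects, NonterminalRespects]

theorem isOPG_of_subset_partitionedMatrix {G : ContextFreeGrammar A} (hop : IsOperatorGrammar G)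
    (h : ∀ a b, opm G a b ⊆ partitionedMatrix kind a b) : IsOPG G :=
  ⟨hop, fun a b => Set.subsingleton_singleton.anti (h a b)⟩

/-- What a word derived from a nonterminal means for the automaton. -/
def VPANT.Sound (M : VPA kind) : VPANT M.Q → List A → Prop
  | body β p q, w => ∀ (x : List A) (s : List M.Γ), (β = true → s = [M.Z₀]) →
      Relation.ReflTransGen M.Step (w ++ x, p, s) (x, q, s)
  | tail p, w => ∀ s : List M.Γ, ∃ q ∈ M.F, ∃ s',
      Relation.ReflTransGen M.Step (w, p, s) ([], q, s')
  | start, w => w ∈ M.language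
  | letter _, _ => True
  | filler, _ => True

theorem VPARule.sound {X : VPANT M.Q} {s : List (Symbol A (VPANT M.Q))} (h : VPARule M X s)
    {w : List A} (hw : Factors (VPANT.Sound M) s w) : VPANT.Sound M X w := by
  cases h with
  | empty β p => rw [Factors.nil_iff.1 hw]; exact fun x s _ => .refl
  | internal β p h =>
    simp only [Factors.nonterminal_iff, Factors.terminal_iff, Factors.nil_iff] at hw
    obtain ⟨u, _, rfl, hu, _, rfl, rfl⟩ := hw
    intro x s hs
    simpa using (hu _ s hs).tail (.internal x s h)
  | matched β p h h' =>
    simp only [Factors.nonterminal_iff, Factors.terminal_iff, Factors.nil_iff] at hw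
    obtain ⟨u, _, rfl, hu, _, rfl, v, _, rfl, hv, _, rfl, rfl⟩ := hw
    intro x s hs
    simpa using (((hu _ s hs).tail (.call _ s h)).trans (hv _ _ (by simp))).tail
      (.ret x s h' (M.call_mem _ _ _ _ h).2)
  | retBottom p h =>
    simp only [Factors.nonterminal_iff, Factors.terminal_iff, Factors.nil_iff] at hw
    obtain ⟨u, _, rfl, hu, _, rfl, rfl⟩ := hw
    intro x s hs
    obtain rfl := hs rfl
    simpa using (hu _ _ hs).tail (.retBottom x [] h)
  | tailEnd p h =>
    simp only [Factors.nonterminal_iff, Factors.nil_iff] at hw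
    obtain ⟨u, _, rfl, hu, rfl⟩ := hw
    exact fun s => ⟨_, h, s, hu [] s (by simp)⟩
  | tailCall p h =>
    simp only [Factors.nonterminal_iff, Factors.terminal_iff, Factors.nil_iff] at hw
    obtain ⟨u, _, rfl, hu, _, rfl, v, _, rfl, hv, rfl⟩ := hw
    intro s
    obtain ⟨q, hq, s', hs'⟩ := hv (_ :: s)
    refine ⟨q, hq, s', ?_⟩
    simpa using ((hu _ s (by simp)).tail (.call _ s h)).trans hs'
  | startEnd hp h =>
    simp only [Factors.nonterminal_iff, Factors.nil_iff] at hw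
    obtain ⟨u, _, rfl, hu, rfl⟩ := hw
    exact ⟨_, hp, _, h, _, hu [] _ fun _ => rfl⟩
  | startCall hp h =>
    simp only [Factors.nonterminal_iff, Factors.terminal_iff, Factors.nil_iff] at hw
    obtain ⟨u, _, rfl, hu, _, rfl, v, _, rfl, hv, rfl⟩ := hw
    obtain ⟨q, hq, s', hs'⟩ := hv (_ :: [M.Z₀])
    refine ⟨_, hp, q, hq, s', ?_⟩
    simpa using ((hu _ _ fun _ => rfl).tail (.call _ _ h)).trans hs'
  | _ => trivial

variable [Finite A]

/-- The grammar of a visibly pushdown automaton. -/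
noncomputable def vpaGrammar (M : VPA kind) : ContextFreeGrammar A where
  NT := VPANT M.Q
  initial := VPANT.start
  rules := (finite_vpaRule M).toFinset

theorem mem_vpaGrammar_rules {r : ContextFreeRule A (VPANT M.Q)} :
    r ∈ (vpaGrammar M).rules ↔ VPARule M r.input r.output :=
  (finite_vpaRule M).mem_toFinset

theorem vpaGrammar_opm_subset (M : VPA kind) : IsOperatorGrammar (vpaGrammar M) ∧
    ∀ a b, opm (vpaGrammar M) a b ⊆ partitionedMatrix kind a b :=
  opm_subset_of_respects (ℓ := VPANT.left kind) (ρ := VPANT.right kind)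
    (fun _ hr => leadIn_vpaRule (mem_vpaGrammar_rules.1 hr))
    (fun _ hr => leadIn_reverse_vpaRule (mem_vpaGrammar_rules.1 hr))
    (fun _ hr => respects_vpaRule (mem_vpaGrammar_rules.1 hr))

theorem VPARule.mem_rules {X : VPANT M.Q} {s : List (Symbol A (VPANT M.Q))} (h : VPARule M X s) :
    (⟨X, s⟩ : ContextFreeRule A (VPANT M.Q)) ∈ (vpaGrammar M).rules :=
  mem_vpaGrammar_rules.2 h

/-- The unreachable rules make the precedence matrix as large as allowed. -/
theorem vpaGrammar_opm_eq (M : VPA kind) : opm (vpaGrammar M) = partitionedMatrix kind := by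
  funext a b
  refine ((vpaGrammar_opm_subset M).2 a b).antisymm ?_
  have hletter (c : A) : (vpaGrammar M).Derives [.nonterminal (VPANT.letter (kind c))]
      [.terminal c] := derives_of_rule (VPARule.letter (M := M) c).mem_rules
  rintro p rfl
  change Holds (vpaGrammar M) _ a b
  have htakes (h : kind a ≠ Kind.call) : Holds (vpaGrammar M) Prec.takes a b :=
    ⟨_, (VPARule.takes (M := M) (b := b) h).mem_rules, [], [], VPANT.letter (kind a), rfl,
      none, [], hletter a⟩
  have hyields (h : kind a = Kind.call) (h' : kind b ≠ Kind.ret) :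
      Holds (vpaGrammar M) Prec.yields a b :=
    ⟨_, (VPARule.yields (M := M) h h').mem_rules, [], [], VPANT.letter (kind b), rfl,
      none, [], hletter b⟩
  rcases ha : kind a with _ | _ | _
  · rcases hb : kind b with _ | _ | _
    · exact hyields ha (by simp [hb])
    · exact ⟨_, (VPARule.equal (M := M) ha hb).mem_rules, [], [], none, rfl⟩
    · exact hyields ha (by simp [hb])
  · exact htakes (by simp [ha])
  · exact htakes (by simp [ha])

/-- The word `w` derives from the nonterminal `X` of the grammar of `M`. -/
def VPANT.Generates (M : VPA kind) (X : VPANT M.Q) (w : List A) : Prop :=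
  GenWord (vpaGrammar M) X w

theorem VPARule.generates {X : VPANT M.Q} {s : List (Symbol A (VPANT M.Q))} (h : VPARule M X s)
    {w : List A} (hw : Factors (VPANT.Generates M) s w) : X.Generates M w :=
  genWord_of_rule h.mem_rules hw

/-- Invariant of the runs of `M`: after reading `w`, the stack lists the pending calls of `w`, and
the words before, between and after these calls derive from the corresponding nonterminals. -/
inductive RunInvariant (M : VPA kind) : List A → M.Q → List M.Γ → Prop
  | bottom {w p q} (hp : p ∈ M.I) (h : VPANT.Generates M (.body true p q) w) :
      RunInvariant M w q [M.Z₀]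
  | push {w q s a p D q' v} (hw : RunInvariant M w q s) (h : (q, a, p, D) ∈ M.δcall)
      (hv : VPANT.Generates M (.body false p q') v) :
      RunInvariant M (w ++ a :: v) q' (D :: s)

theorem RunInvariant.extend {w y : List A} {q q' : M.Q} {s : List M.Γ}
    (h : RunInvariant M w q s)
    (hy : ∀ β p u, VPANT.Generates M (.body β p q) u →
      VPANT.Generates M (.body β p q') (u ++ y)) :
    RunInvariant M (w ++ y) q' s := by
  cases h with
  | bottom hp h => exact .bottom hp (hy _ _ _ h)
  | push hw h hv => simpa using hw.push h (hy _ _ _ hv)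

theorem RunInvariant.step {w x x' : List A} {q q' : M.Q} {s s' : List M.Γ}
    (h : RunInvariant M w q s) (hs : M.Step (x, q, s) (x', q', s')) :
    ∃ y, x = y ++ x' ∧ RunInvariant M (w ++ y) q' s' := by
  cases hs with
  | @call _ a _ _ _ _ hδ =>
    exact ⟨[a], rfl, h.push hδ ((VPARule.empty _ _).generates (by simp))⟩
  | @internal _ a _ _ _ hδ =>
    exact ⟨[a], rfl, h.extend fun β p u hu => (VPARule.internal β p hδ).generates (by simp [hu])⟩
  | @ret _ a _ _ _ _ hδ hD =>
    refine ⟨[a], rfl, ?_⟩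
    cases h with
    | bottom => exact absurd rfl hD
    | @push _ _ _ b _ _ _ v hw h hv =>
      have := hw.extend (y := b :: (v ++ [a])) fun β p u hu =>
        (VPARule.matched β p h hδ).generates (.nonterminal hu (.terminal _ (.nonterminal hv (.terminal _ .nil))))
      simpa using this
  | @retBottom _ a _ _ s hδ =>
    refine ⟨[a], rfl, ?_⟩
    cases h with
    | bottom hp h => exact .bottom hp ((VPARule.retBottom _ hδ).generates (by simp [h]))
    | push _ h => exact absurd rfl (M.call_mem _ _ _ _ h).2

theorem RunInvariant.generates_start {w : List A} {q : M.Q} {s : List M.Γ}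
    (h : RunInvariant M w q s) {y : List A}
    (hy : (q ∈ M.F ∧ y = []) ∨ ∃ a q' D v, (q, a, q', D) ∈ M.δcall ∧
      VPANT.Generates M (.tail q') v ∧ y = a :: v) :
    VPANT.start.Generates M (w ++ y) := by
  induction h generalizing y with
  | bottom hp h =>
    rcases hy with ⟨hq, rfl⟩ | ⟨a, q', D, v, hδ, hv, rfl⟩
    · exact (VPARule.startEnd hp hq).generates (by simpa using h)
    · exact (VPARule.startCall hp hδ).generates (.nonterminal h (.terminal _ (.singleton hv)))
  | @push w _ _ b _ _ _ u hw h hu ih =>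
    rw [List.append_assoc]
    refine ih (.inr ⟨_, _, _, u ++ y, h, ?_, rfl⟩)
    rcases hy with ⟨hq, rfl⟩ | ⟨a, q', D, v, hδ, hv, rfl⟩
    · exact (VPARule.tailEnd _ hq).generates (by simpa using hu)
    · exact (VPARule.tailCall _ hδ).generates (.nonterminal hu (.terminal _ (.singleton hv)))

theorem vpaGrammar_language (M : VPA kind) : (vpaGrammar M).language = M.language := by
  ext w
  constructor
  · intro h
    exact GenWord.induction (P := VPANT.Sound M) (X := VPANT.start) (fun r hr u hu =>
      (mem_vpaGrammar_rules.1 hr).sound (hu.mono fun _ _ h => h.2)) h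
  · rintro ⟨p, hp, q, hq, s, h⟩
    have key : ∀ c c', Relation.ReflTransGen M.Step c c' → ∀ w, RunInvariant M w c.2.1 c.2.2 →
        ∃ y, c.1 = y ++ c'.1 ∧ RunInvariant M (w ++ y) c'.2.1 c'.2.2 := by
      intro c c' h
      induction h using Relation.ReflTransGen.head_induction_on with
      | refl => exact fun w hw => ⟨[], rfl, by simpa using hw⟩
      | head h _ ih =>
        intro w hw
        obtain ⟨y, hy, hw⟩ := hw.step h
        obtain ⟨z, hz, hw⟩ := ih _ hw
        exact ⟨y ++ z, by rw [hy, hz, List.append_assoc], by rwa [← List.append_assoc]⟩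
    obtain ⟨y, hy, hw⟩ := key _ _ h [] (.bottom hp ((VPARule.empty _ _).generates (by simp)))
    obtain rfl : w = y := by simpa using hy
    have := hw.generates_start (.inl ⟨hq, rfl⟩)
    rwa [List.nil_append, List.append_nil] at this

end OfVPA

/-! ### From an operator precedence grammar to a visibly pushdown automaton -/

section ToVPA

universe u

variable {A : Type u} (G : ContextFreeGrammar A)

/-- The nonterminals that matter: the axiom and those having a rule. There are finitely many. -/
abbrev RuleNT : Type := {X : G.NT // X = G.initial ∨ ∃ r ∈ G.rules, r.input = X}

instance : Finite (RuleNT G) := by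
  have : ({G.initial} ∪ ContextFreeRule.input '' (↑G.rules : Set (ContextFreeRule A G.NT))).Finite :=
    (Set.finite_singleton _).union (G.rules.finite_toSet.image _)
  exact (this.subset (t := {X | X = G.initial ∨ ∃ r ∈ G.rules, r.input = X}) (by
    rintro X (rfl | ⟨r, hr, rfl⟩)
    exacts [.inl rfl, .inr ⟨r, hr, rfl⟩])).to_subtype

/-- The string of length at most one given by an optional nonterminal. -/
def form (X : Option (RuleNT G)) : List (Symbol A G.NT) := optNT G (X.map Subtype.val)

variable {G} {kind : A → Kind}

/-- The left terminals of an optional nonterminal. -/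
def optLeft (X : Option G.NT) : Set A := {a | ∃ D, X = some D ∧ a ∈ leftTerminals G D}

/-- The right terminals of an optional nonterminal. -/
def optRight (X : Option G.NT) : Set A := {a | ∃ D, X = some D ∧ a ∈ rightTerminals G D}

theorem IsOperatorGrammar.suffix_cases (hG : IsOperatorGrammar G) {r : ContextFreeRule A G.NT}
    (hr : r ∈ G.rules) {α s : List (Symbol A G.NT)} (h : r.output = α ++ s) :
    ∃ X, s = optNT G X ∨ ∃ a t, s = optNT G X ++ .terminal a :: t := by
  match s, h with
  | [], _ => exact ⟨none, .inl rfl⟩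
  | .terminal a :: t, _ => exact ⟨none, .inr ⟨a, t, rfl⟩⟩
  | [.nonterminal X], _ => exact ⟨some X, .inl rfl⟩
  | .nonterminal X :: .terminal a :: t, _ => exact ⟨some X, .inr ⟨a, t, rfl⟩⟩
  | .nonterminal X :: .nonterminal Y :: t, h => exact absurd h (hG r hr α t X Y)

theorem equal_of_opm_subset (hM : ∀ a b, opm G a b ⊆ partitionedMatrix kind a b)
    {r : ContextFreeRule A G.NT} (hr : r ∈ G.rules) {α β : List (Symbol A G.NT)}
    {a b : A} {X : Option G.NT}
    (h : r.output = α ++ .terminal a :: (optNT G X ++ .terminal b :: β)) :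
    kind a = Kind.call ∧ kind b = Kind.ret := by
  have := hM a b (show Prec.equal ∈ opm G a b from ⟨r, hr, α, β, X, h⟩)
  cases ha : kind a <;> cases hb : kind b <;> simp_all [partitionedMatrix, Kind.prec]

theorem yields_of_opm_subset (hM : ∀ a b, opm G a b ⊆ partitionedMatrix kind a b)
    {r : ContextFreeRule A G.NT} (hr : r ∈ G.rules) {α β : List (Symbol A G.NT)}
    {a b : A} {X : Option G.NT}
    (h : r.output = α ++ .terminal a :: (optNT G X ++ β)) (hb : b ∈ optLeft X) :
    kind a = Kind.call ∧ kind b ≠ Kind.ret := by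
  obtain ⟨D, rfl, hb⟩ := hb
  have := hM a b (show Prec.yields ∈ opm G a b from ⟨r, hr, α, β, D, h, hb⟩)
  cases ha : kind a <;> cases hb : kind b <;> simp_all [partitionedMatrix, Kind.prec]

theorem takes_of_opm_subset (hM : ∀ a b, opm G a b ⊆ partitionedMatrix kind a b)
    {r : ContextFreeRule A G.NT} (hr : r ∈ G.rules) {α β : List (Symbol A G.NT)}
    {a b : A} {X : Option G.NT}
    (h : r.output = α ++ (optNT G X ++ .terminal b :: β)) (ha : a ∈ optRight X) :
    kind a ≠ Kind.call := by
  obtain ⟨D, rfl, ha⟩ := ha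
  have := hM a b (show Prec.takes ∈ opm G a b from ⟨r, hr, α, β, D, h, ha⟩)
  cases ha : kind a <;> cases hb : kind b <;> simp_all [partitionedMatrix, Kind.prec]

theorem optLeft_subset {r : ContextFreeRule A G.NT} (hr : r ∈ G.rules)
    {s : List (Symbol A G.NT)} {X : Option G.NT} (h : r.output = optNT G X ++ s) :
    optLeft X ⊆ leftTerminals G r.input := by
  rintro a ⟨D, rfl, B, α, hD⟩
  refine ⟨B, α ++ s, (h ▸ derives_of_rule hr).trans ?_⟩
  simpa [optNT] using hD.append_right s

theorem optRight_subset {r : ContextFreeRule A G.NT} (hr : r ∈ G.rules)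
    {s : List (Symbol A G.NT)} {X : Option G.NT} (h : r.output = s ++ optNT G X) :
    optRight X ⊆ rightTerminals G r.input := by
  rintro a ⟨D, rfl, B, α, hD⟩
  refine ⟨B, s ++ α, (h ▸ derives_of_rule hr).trans ?_⟩
  simpa [optNT] using hD.append_left s

theorem mem_leftTerminals {r : ContextFreeRule A G.NT} (hr : r ∈ G.rules)
    {s : List (Symbol A G.NT)} {X : Option G.NT} {a : A}
    (h : r.output = optNT G X ++ .terminal a :: s) : a ∈ leftTerminals G r.input :=
  ⟨X, s, h ▸ derives_of_rule hr⟩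

theorem mem_rightTerminals {r : ContextFreeRule A G.NT} (hr : r ∈ G.rules)
    {s : List (Symbol A G.NT)} {X : Option G.NT} {a : A}
    (h : r.output = s ++ .terminal a :: optNT G X) : a ∈ rightTerminals G r.input :=
  ⟨X, s, h ▸ derives_of_rule hr⟩

/-- An optional nonterminal that derives a terminal word is one of the automaton. -/
theorem exists_form_eq {X : Option G.NT} {w : List A}
    (h : G.Derives (optNT G X) (w.map .terminal)) : ∃ P, form G P = optNT G X := by
  cases X with
  | none => exact ⟨none, rfl⟩
  | some X =>
    by_cases hX : ∃ r ∈ G.rules, r.input = X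
    · exact ⟨some ⟨X, .inr hX⟩, rfl⟩
    · push Not at hX
      refine absurd h (ContextFreeGrammar.derives_nonterminal hX _ fun h' => ?_)
      cases w <;> simp at h'

variable (G) (kind)

/-- States of the automaton of a grammar. The component `goal` is `some P` if no open call is
expected to be matched, and then the rest of the input, together with the current level, has to
derive from `P`; it is `none` below a call that is expected to be matched. The component `level`
derives the word read since the last open call, or since the beginning if there is none. -/
structure ParseState where
  goal : Option (Option (RuleNT G))
  level : Option (RuleNT G)

/-- Stack symbols of the automaton of a grammar: the bottom, a call that will never be matched, and a
call `c` that will be matched, with the state in which it was read. The call is stored as a number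
so that the stack symbols form a type in the lowest universe. -/
inductive ParseSymbol where
  | bottom
  | pending
  | matched (q : ParseState G) (c : Fin (Nat.card A))

instance : Finite (ParseState G) :=
  Finite.of_surjective (fun x : Option (Option (RuleNT G)) × Option (RuleNT G) =>
    (⟨x.1, x.2⟩ : ParseState G)) fun ⟨g, X⟩ => ⟨(g, X), rfl⟩

instance : Finite (ParseSymbol G) := by
  refine Finite.of_surjective (α := Bool ⊕ ParseState G × Fin (Nat.card A)) (fun x => match x with
    | .inl true => .bottom
    | .inl false => .pending
    | .inr (q, c) => .matched q c) ?_
  rintro (_ | _ | ⟨q, c⟩)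
  exacts [⟨.inl true, rfl⟩, ⟨.inl false, rfl⟩, ⟨.inr (q, c), rfl⟩]

variable [Finite A]

/-- Call moves of the automaton of a grammar: whether the call will be matched is guessed. -/
inductive ParseCall : ParseState G → A → ParseState G → ParseSymbol G → Prop
  | pending {P X P'} (c : A)
      (h : G.Derives (form G P) (form G X ++ .terminal c :: form G P')) :
      ParseCall ⟨some P, X⟩ c ⟨some P', none⟩ .pending
  | matched (q : ParseState G) (c : A) :
      ParseCall q c ⟨none, none⟩ (.matched q (Finite.equivFin A c))

/-- Return moves of the automaton of a grammar. -/
inductive ParseRet : ParseState G → A → ParseSymbol G → ParseState G → Prop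
  | bottom {g X Y} (b : A) (h : G.Derives (form G (some Y)) (form G X ++ [.terminal b])) :
      ParseRet ⟨g, X⟩ b .bottom ⟨g, some Y⟩
  | matched {g X Y Z} (c b : A) (h : G.Derives (form G (some Z))
      (form G X ++ .terminal c :: (form G Y ++ [.terminal b]))) :
      ParseRet ⟨none, Y⟩ b (.matched ⟨g, X⟩ (Finite.equivFin A c)) ⟨g, some Z⟩

/-- Internal moves of the automaton of a grammar. -/
inductive ParseInt : ParseState G → A → ParseState G → Prop
  | intro {g X Y} (a : A) (h : G.Derives (form G (some Y)) (form G X ++ [.terminal a])) :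
      ParseInt ⟨g, X⟩ a ⟨g, some Y⟩

/-- The automaton of a grammar over an alphabet partitioned by `kind`. -/
def parser : VPA kind where
  Q := ParseState G
  Γ := ParseSymbol G
  finite_Q := inferInstance
  finite_Γ := inferInstance
  I := {⟨some (some ⟨G.initial, .inl rfl⟩), none⟩}
  F := {q | ∃ P, q.goal = some P ∧ G.Derives (form G P) (form G q.level)}
  Z₀ := .bottom
  δcall := {x | kind x.2.1 = Kind.call ∧ ParseCall G x.1 x.2.1 x.2.2.1 x.2.2.2}
  δret := {x | kind x.2.1 = Kind.ret ∧ ParseRet G x.1 x.2.1 x.2.2.1 x.2.2.2}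
  δint := {x | kind x.2.1 = Kind.internal ∧ ParseInt G x.1 x.2.1 x.2.2}
  call_mem _ _ _ _ h := ⟨h.1, by
    obtain ⟨-, h⟩ := h
    dsimp only at h
    cases h <;> simp⟩
  ret_mem _ _ _ _ h := h.1
  int_mem _ _ _ h := h.1

variable {G} {kind}

/-- Invariant of the runs of the automaton of a grammar: after reading `w`, the stack lists the
pending calls of `w`, and the words between them derive from the nonterminals stored. -/
inductive ParseInvariant : List A → ParseState G → List (ParseSymbol G) → Prop
  | bottom {w X} (h : G.Derives (form G X) (w.map .terminal)) :
      ParseInvariant w ⟨some (some ⟨G.initial, .inl rfl⟩), X⟩ [.bottom]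
  | pending {w P X P' Y s c v} (hw : ParseInvariant w ⟨some P, X⟩ s)
      (hP : G.Derives (form G P) (form G X ++ .terminal c :: form G P'))
      (hv : G.Derives (form G Y) (v.map .terminal)) :
      ParseInvariant (w ++ c :: v) ⟨some P', Y⟩ (.pending :: s)
  | matched {w q Y s c v} (hw : ParseInvariant w q s)
      (hv : G.Derives (form G Y) (v.map .terminal)) :
      ParseInvariant (w ++ c :: v) ⟨none, Y⟩ (.matched q (Finite.equivFin A c) :: s)

theorem ParseInvariant.extend {w y : List A} {g X Y} {s : List (ParseSymbol G)}
    (h : ParseInvariant w ⟨g, X⟩ s)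
    (hy : G.Derives (form G Y) (form G X ++ y.map .terminal)) :
    ParseInvariant (w ++ y) ⟨g, Y⟩ s := by
  have key (u : List A) (hu : G.Derives (form G X) (u.map .terminal)) :
      G.Derives (form G Y) ((u ++ y).map .terminal) := by
    rw [List.map_append]
    exact hy.trans (hu.append_right _)
  cases h with
  | bottom h => exact .bottom (key _ h)
  | pending hw hP hv => simpa using hw.pending hP (key _ hv)
  | matched hw hv => simpa using hw.matched (key _ hv)

theorem ParseInvariant.step {w x x' : List A} {q q' : ParseState G} {s s' : List (ParseSymbol G)}
    (h : ParseInvariant w q s) (hs : (parser G kind).Step (x, q, s) (x', q', s')) :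
    ∃ y, x = y ++ x' ∧ ParseInvariant (w ++ y) q' s' := by
  cases hs with
  | call _ _ h' =>
    refine ⟨[_], rfl, ?_⟩
    obtain ⟨-, h'⟩ := h'
    dsimp only at h'
    cases h' with
    | pending _ h' => exact h.pending h' Relation.ReflTransGen.refl
    | matched => exact h.matched Relation.ReflTransGen.refl
  | internal _ _ h' =>
    refine ⟨[_], rfl, ?_⟩
    obtain ⟨-, h'⟩ := h'
    dsimp only at h'
    cases h' with
    | intro _ h' => exact h.extend h'
  | @ret _ b _ _ _ _ h' hD =>
    refine ⟨[_], rfl, ?_⟩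
    obtain ⟨-, h'⟩ := h'
    dsimp only at h'
    cases h' with
    | bottom => exact absurd rfl hD
    | @matched _ _ _ Z c _ h' =>
      generalize hn : Finite.equivFin A c = n at h
      cases h with
      | @matched _ _ _ _ c' v hw hv =>
        obtain rfl : c = c' := (Finite.equivFin A).injective hn
        have := hw.extend (y := c :: (v ++ [b])) (Y := some Z) <| h'.trans <| by
          simpa using (derives_cons _ (hv.append_right [Symbol.terminal b])).append_left _
        simpa using this
  | retBottom _ _ h' =>
    refine ⟨[_], rfl, ?_⟩
    obtain ⟨-, h'⟩ := h'
    generalize hZ : (parser G kind).Z₀ = Z at h'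
    cases h' with
    | bottom _ h' => exact h.extend h'
    | matched => cases hZ

theorem ParseInvariant.derives {w : List A} {q : ParseState G} {s : List (ParseSymbol G)}
    (h : ParseInvariant w q s) {P} (hP : q.goal = some P) {y : List (Symbol A G.NT)}
    (hy : G.Derives (form G P) (form G q.level ++ y)) :
    G.Derives [.nonterminal G.initial] (w.map .terminal ++ y) := by
  induction h generalizing P y with
  | bottom h => cases hP; exact hy.trans (h.append_right _)
  | pending hw hP' hv ih =>
    cases hP
    have := ih rfl (hP'.trans ((derives_cons _ (hy.trans (hv.append_right _))).append_left _))
    simpa using this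
  | matched => cases hP

theorem parser_language_subset : (parser G kind).language ≤ G.language := by
  rintro w ⟨_, rfl, q, ⟨P, hP, hq⟩, s, h⟩
  have key : ∀ c c', Relation.ReflTransGen (parser G kind).Step c c' → ∀ w,
      ParseInvariant w c.2.1 c.2.2 → ∃ y, c.1 = y ++ c'.1 ∧
        ParseInvariant (w ++ y) c'.2.1 c'.2.2 := by
    intro c c' h
    induction h using Relation.ReflTransGen.head_induction_on with
    | refl => exact fun w hw => ⟨[], rfl, by simpa using hw⟩
    | head h _ ih =>
      intro w hw
      obtain ⟨y, hy, hw⟩ := hw.step h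
      obtain ⟨z, hz, hw⟩ := ih _ hw
      exact ⟨y ++ z, by rw [hy, hz, List.append_assoc], by rwa [← List.append_assoc]⟩
  obtain ⟨y, hy, hw⟩ := key _ _ h [] (.bottom Relation.ReflTransGen.refl)
  obtain rfl : w = y := by simpa using hy
  have := hw.derives hP (y := []) (by simpa using hq)
  rwa [List.append_nil] at this

/-- The word `w`, derived from `X`, can be read without changing the stack, starting with an empty
level and ending in a level derivable from `X`. This is claimed if `X` has no call as a right
terminal, which excludes pending calls, and if the stack is at its bottom or `X` has no return as a
left terminal, which excludes popping the symbols below. -/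
def LevelRun (kind : A → Kind) (X : Option G.NT) (w : List A) : Prop :=
  (∀ a ∈ optRight X, kind a ≠ Kind.call) →
    ∀ (g : Option (Option (RuleNT G))) (s : List (ParseSymbol G)),
      (s = [.bottom] ∨ ∀ a ∈ optLeft X, kind a ≠ Kind.ret) →
      ∃ Y, G.Derives (optNT G X) (form G Y) ∧ ∀ x : List A,
        Relation.ReflTransGen (parser G kind).Step (w ++ x, ⟨g, none⟩, s) (x, ⟨g, Y⟩, s)

/-- The word `w`, derived from `X`, can be read with any goal that derives `X`, starting with an
empty level and ending in an accepting state. Pending calls are allowed, and they change the goal. -/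
def GoalRun (kind : A → Kind) (X : Option G.NT) (w : List A) : Prop :=
  ∀ (P : Option (RuleNT G)) (s : List (ParseSymbol G)), G.Derives (form G P) (optNT G X) →
    (s = [.bottom] ∨ ∀ a ∈ optLeft X, kind a ≠ Kind.ret) →
    ∃ P' Y s', G.Derives (form G P') (form G Y) ∧
      Relation.ReflTransGen (parser G kind).Step (w, ⟨some P, none⟩, s) ([], ⟨some P', Y⟩, s')

theorem levelRun_none : LevelRun kind (none : Option G.NT) [] :=
  fun _ _ _ _ => ⟨none, Relation.ReflTransGen.refl, fun _ => Relation.ReflTransGen.refl⟩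

theorem goalRun_none : GoalRun kind (none : Option G.NT) [] :=
  fun P s hP _ => ⟨P, none, s, hP, Relation.ReflTransGen.refl⟩

/-- What is known about the words derived from a proper subtree of a derivation tree. -/
def ParseHyp (kind : A → Kind) (X : G.NT) (w : List A) : Prop :=
  GenWord G X w ∧ LevelRun kind (some X) w ∧ GoalRun kind (some X) w

theorem Factors.optNT_runs {X : Option G.NT} {w : List A}
    (h : Factors (ParseHyp (G := G) kind) (optNT G X) w) :
    LevelRun kind X w ∧ GoalRun kind X w := by
  cases X with
  | none => rw [Factors.nil_iff.1 h]; exact ⟨levelRun_none, goalRun_none⟩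
  | some X =>
    obtain ⟨u, v, rfl, hu, hv⟩ := Factors.nonterminal_iff.1 h
    rw [Factors.nil_iff.1 hv, List.append_nil]
    exact hu.2

theorem Factors.optNT_derives {X : Option G.NT} {w : List A}
    (h : Factors (ParseHyp (G := G) kind) (optNT G X) w) :
    G.Derives (optNT G X) (w.map .terminal) :=
  (h.mono fun _ _ h => h.1).derives

/-- A nonterminal without left terminals derives at most the empty word. -/
theorem Factors.eq_nil_of_optLeft {X : Option G.NT} {w : List A}
    (h : Factors (ParseHyp (G := G) kind) (optNT G X) w) (hX : ∀ a, a ∉ optLeft X) : w = [] := by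
  cases X with
  | none => exact Factors.nil_iff.1 h
  | some X =>
    cases w with
    | nil => rfl
    | cons a w => exact absurd ⟨X, rfl, none, w.map .terminal, h.optNT_derives⟩ (hX a)

/-- The two claims about runs for a rule, given what is known about its right-hand side. -/
theorem runs_of_rule (hG : IsOperatorGrammar G)
    (hM : ∀ a b, opm G a b ⊆ partitionedMatrix kind a b) {r : ContextFreeRule A G.NT}
    (hr : r ∈ G.rules) {w : List A} (hw : Factors (ParseHyp (G := G) kind) r.output w) :
    LevelRun kind (some r.input) w ∧ GoalRun kind (some r.input) w := by
  -- A run on one level serves every goal that derives the left-hand side.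
  have goalRun_of_levelRun (h : ∀ (g : Option (Option (RuleNT G))) (s : List (ParseSymbol G)),
      (s = [.bottom] ∨ ∀ a ∈ optLeft (some r.input), kind a ≠ Kind.ret) →
      ∃ Y, G.Derives (optNT G (some r.input)) (form G Y) ∧ ∀ x : List A,
        Relation.ReflTransGen (parser G kind).Step (w ++ x, ⟨g, none⟩, s) (x, ⟨g, Y⟩, s)) :
      LevelRun kind (some r.input) w ∧ GoalRun kind (some r.input) w := by
    refine ⟨fun _ => h, fun P s hP hs => ?_⟩
    obtain ⟨Y, hY, hrun⟩ := h (some P) s hs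
    exact ⟨P, Y, s, hP.trans hY, by simpa using hrun []⟩
  have hinput : G.Derives (optNT G (some r.input)) r.output := derives_of_rule hr
  let N : RuleNT G := ⟨r.input, .inr ⟨r, hr, rfl⟩⟩
  have hN : G.Derives (form G (some N)) r.output := hinput
  have safe {X : Option G.NT} {t : List (Symbol A G.NT)} (hX : r.output = optNT G X ++ t)
      {s : List (ParseSymbol G)}
      (hs : s = [.bottom] ∨ ∀ a ∈ optLeft (some r.input), kind a ≠ Kind.ret) :
      s = [.bottom] ∨ ∀ a ∈ optLeft X, kind a ≠ Kind.ret :=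
    hs.imp_right fun h a ha => h a ⟨_, rfl, optLeft_subset hr hX ha⟩
  obtain ⟨X, hX | ⟨a, t, hX⟩⟩ := hG.suffix_cases hr (List.nil_append _).symm
  · -- The right-hand side has no terminal.
    rw [hX] at hw hinput
    obtain ⟨hlev, hgoal⟩ := hw.optNT_runs
    have hX' : r.output = optNT G X ++ [] := by simpa using hX
    constructor
    · intro hR g s hs
      obtain ⟨Y, hY, hrun⟩ := hlev
        (fun a ha => hR a ⟨_, rfl, optRight_subset hr (s := []) hX ha⟩) g s (safe hX' hs)
      exact ⟨Y, hinput.trans hY, hrun⟩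
    · intro P s hP hs
      exact hgoal P s (hP.trans hinput) (safe hX' hs)
  rw [hX] at hw
  obtain ⟨u, _, rfl, hu, hw⟩ := hw.exists_append
  obtain ⟨v, rfl, hv⟩ := Factors.terminal_iff.1 hw
  have hlevX := hu.optNT_runs.1 fun b hb => takes_of_opm_subset hM hr (α := []) hX hb
  have hXt : r.output = (optNT G X ++ [.terminal a]) ++ t := by simpa using hX
  obtain ⟨Y, hY | ⟨b, t', hY⟩⟩ := hG.suffix_cases hr hXt
  · subst hY
    by_cases ha : kind a = Kind.call
    · -- The terminal is a pending call.
      refine ⟨fun h => absurd ha (h a ⟨_, rfl, mem_rightTerminals hr hX⟩), fun P s hP hs => ?_⟩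
      obtain ⟨X', hX', hrun⟩ := hlevX (some P) s (safe hX hs)
      obtain ⟨P', hP'⟩ := exists_form_eq hv.optNT_derives
      obtain ⟨Q, Z, s', hQ, hrun'⟩ := hv.optNT_runs.2 P' (.pending :: s)
        (hP' ▸ Relation.ReflTransGen.refl)
        (.inr fun b hb => (yields_of_opm_subset hM hr (β := []) (by simpa using hX) hb).2)
      refine ⟨Q, Z, s', hQ, ((hrun (a :: v)).tail (.call (M := parser G kind) v s ⟨ha, .pending a ?_⟩)).trans hrun'⟩
      rw [hP']
      exact (hP.trans hinput).trans (hX ▸ hX'.append_right _)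
    · -- The terminal is internal or an unmatched return; nothing but the empty word follows it.
      obtain rfl := hv.eq_nil_of_optLeft fun b hb =>
        ha (yields_of_opm_subset hM hr (β := []) (by simpa using hX) hb).1
      apply goalRun_of_levelRun
      intro g s hs
      obtain ⟨X', hX', hrun⟩ := hlevX g s (safe hX hs)
      have hN' : G.Derives (form G (some N)) (form G X' ++ [.terminal a]) := by
        refine hN.trans (hX ▸ derives_append hX' (derives_cons _ hv.optNT_derives))
      refine ⟨some N, Relation.ReflTransGen.refl, fun x => ?_⟩
      have hrun := hrun (a :: x)
      rw [List.append_assoc]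
      cases hk : kind a with
      | call => exact absurd hk ha
      | internal => exact hrun.tail (.internal (M := parser G kind) x s ⟨hk, .intro a hN'⟩)
      | ret =>
        rcases hs with rfl | hs
        · exact hrun.tail (.retBottom (M := parser G kind) x [] ⟨hk, .bottom a hN'⟩)
        · exact absurd hk (hs a ⟨_, rfl, mem_leftTerminals hr hX⟩)
  · -- The right-hand side begins with a call and the matching return.
    subst hY
    obtain ⟨ha, hb⟩ := equal_of_opm_subset hM hr hX
    obtain ⟨v, _, rfl, hy, hw⟩ := hv.exists_append
    obtain ⟨z, rfl, hz⟩ := Factors.terminal_iff.1 hw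
    have hXb : r.output = (optNT G X ++ .terminal a :: (optNT G Y ++ [.terminal b])) ++ t' := by
      simpa using hX
    have hXb' : r.output = (optNT G X ++ .terminal a :: optNT G Y) ++ .terminal b :: t' := by
      simpa using hX
    obtain ⟨Z, hZ | ⟨c, t, hZ⟩⟩ := hG.suffix_cases hr hXb
    · subst hZ
      obtain rfl := hz.eq_nil_of_optLeft fun c hc => by
        have := (yields_of_opm_subset hM hr (α := optNT G X ++ .terminal a :: optNT G Y)
          (β := []) (by simpa using hX) hc).1
        simp [hb] at this
      apply goalRun_of_levelRun
      intro g s hs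
      obtain ⟨X', hX', hrun⟩ := hlevX g s (safe hX hs)
      obtain ⟨Y', hY', hrun'⟩ := hy.optNT_runs.1
        (fun c hc => takes_of_opm_subset hM hr (α := optNT G X ++ [.terminal a])
          (by simpa using hX) hc) none
        (.matched ⟨g, X'⟩ (Finite.equivFin A a) :: s)
        (.inr fun c hc => (yields_of_opm_subset hM hr hX hc).2)
      refine ⟨some N, Relation.ReflTransGen.refl, fun x => ?_⟩
      have hN' : G.Derives (form G (some N))
          (form G X' ++ .terminal a :: (form G Y' ++ [.terminal b])) :=
        hN.trans (hX ▸ derives_append hX' (derives_cons _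
          (derives_append hY' (derives_cons _ hz.optNT_derives))))
      have := (((hrun (a :: (v ++ b :: x))).tail (.call (M := parser G kind) _ s ⟨ha, .matched _ a⟩)).trans
        (hrun' (b :: x))).tail
          (.ret (M := parser G kind) x s ⟨hb, .matched a b hN'⟩ (by simp [parser]))
      simpa using this
    · -- A third terminal would have to be a return, while the second one would be a call.
      subst hZ
      have := (equal_of_opm_subset hM hr hXb').1
      simp [hb] at this

/-- The automaton of a grammar recognizes its language if the precedence matrix is contained in the
partitioned one. -/
theorem parser_language (hG : IsOperatorGrammar G)
    (hM : ∀ a b, opm G a b ⊆ partitionedMatrix kind a b) :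
    (parser G kind).language = G.language := by
  refine le_antisymm parser_language_subset fun w hw => ?_
  have := (GenWord.induction (P := fun X w => LevelRun kind (some X) w ∧ GoalRun kind (some X) w)
    (fun r hr u hu => runs_of_rule hG hM hr hu) hw).2
  obtain ⟨P, Y, s, hP, hrun⟩ := this (some ⟨G.initial, .inl rfl⟩) [.bottom]
    Relation.ReflTransGen.refl (.inl rfl)
  exact ⟨_, rfl, _, ⟨P, rfl, hP⟩, s, hrun⟩

end ToVPA

/-! ### Operator precedence grammars for the two languages -/

section Grammars

/-- The precedence matrix with at most one relation per cell given by a table. -/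
def tableMatrix {A : Type*} (T : A → A → Option Prec) : PrecMatrix A := fun a b => {p | T a b = some p}

theorem isOPG_of_tableMatrix {A : Type*} {G : ContextFreeGrammar A} {T : A → A → Option Prec}
    (h : IsOperatorGrammar G ∧ ∀ a b, opm G a b ⊆ tableMatrix T a b) : IsOPG G :=
  ⟨h.1, fun a b _ hp _ hp' => Option.some_injective _ ((h.2 a b hp).symm.trans (h.2 a b hp'))⟩

/-- Nonterminals of a grammar for `langBlocks`: the axiom, the words `bⁿ cⁿ`, the words `bⁿ e`. -/
inductive BlocksNT where
  | start
  | bc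
  | be

open Symbol BlocksNT in
/-- The rules of a grammar for `langBlocks`. -/
def blocksRules : Set (ContextFreeRule Letter BlocksNT) := {
  ⟨start, [terminal .a, nonterminal start, terminal .d]⟩,
  ⟨start, [terminal .a, nonterminal bc, terminal .d]⟩,
  ⟨start, [terminal .a, nonterminal be, terminal .d]⟩,
  ⟨bc, [terminal .b, nonterminal bc, terminal .c]⟩,
  ⟨bc, [terminal .b, terminal .c]⟩,
  ⟨be, [terminal .b, nonterminal be]⟩,
  ⟨be, [terminal .b, terminal .e]⟩}

theorem finite_blocksRules : blocksRules.Finite := by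
  unfold blocksRules
  exact Set.toFinite _

/-- A grammar for `langBlocks`. -/
noncomputable def blocksGrammar : ContextFreeGrammar Letter where
  NT := BlocksNT
  initial := .start
  rules := finite_blocksRules.toFinset

/-- The precedence relations of the grammar for `langBlocks`. -/
def blocksTable : Letter → Letter → Option Prec
  | .a, .a => some .yields
  | .a, .b => some .yields
  | .a, .d => some .equal
  | .b, .b => some .yields
  | .b, .c => some .equal
  | .b, .e => some .equal
  | .b, .d => some .takes
  | .c, .c => some .takes
  | .c, .d => some .takes
  | .d, .d => some .takes
  | .e, .d => some .takes
  | _, _ => none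

/-- The left terminals in the grammar for `langBlocks`. -/
def BlocksNT.left : BlocksNT → Set Letter
  | start => {.a}
  | bc => {.b}
  | be => {.b}

/-- The right terminals in the grammar for `langBlocks`. -/
def BlocksNT.right : BlocksNT → Set Letter
  | start => {.d}
  | bc => {.c}
  | be => {.b, .e}

theorem forall_blocksGrammar_rules {p : ContextFreeRule Letter BlocksNT → Prop} :
    (∀ r ∈ blocksGrammar.rules, p r) ↔
      p ⟨.start, [.terminal .a, .nonterminal .start, .terminal .d]⟩ ∧
      p ⟨.start, [.terminal .a, .nonterminal .bc, .terminal .d]⟩ ∧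
      p ⟨.start, [.terminal .a, .nonterminal .be, .terminal .d]⟩ ∧
      p ⟨.bc, [.terminal .b, .nonterminal .bc, .terminal .c]⟩ ∧
      p ⟨.bc, [.terminal .b, .terminal .c]⟩ ∧
      p ⟨.be, [.terminal .b, .nonterminal .be]⟩ ∧
      p ⟨.be, [.terminal .b, .terminal .e]⟩ := by
  rw [show (∀ r ∈ blocksGrammar.rules, p r) ↔ ∀ r ∈ blocksRules, p r from
    forall_congr' fun _ => imp_congr_left finite_blocksRules.mem_toFinset]
  simp [blocksRules]

theorem isOPG_blocksGrammar : IsOPG blocksGrammar := by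
  refine isOPG_of_tableMatrix (T := blocksTable)
    (opm_subset_of_respects (ℓ := BlocksNT.left) (ρ := BlocksNT.right)
      (forall_blocksGrammar_rules (p := fun r =>
        LeadIn BlocksNT.left (BlocksNT.left r.input) r.output).2 ?_)
      (forall_blocksGrammar_rules (p := fun r =>
        LeadIn BlocksNT.right (BlocksNT.right r.input) r.output.reverse).2 ?_)
      (forall_blocksGrammar_rules (p := fun r =>
        Respects (tableMatrix blocksTable) BlocksNT.left BlocksNT.right r.output).2 ?_)) <;>
  simp [LeadIn, Respects, TerminalRespects, NonterminalRespects, BlocksNT.left, BlocksNT.right,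
    tableMatrix, blocksTable]

/-- The words derived from a nonterminal of the grammar for `langBlocks`. -/
def BlocksNT.Word : BlocksNT → List Letter → Prop
  | start, w => w ∈ langBlocks
  | bc, w => ∃ n, 1 ≤ n ∧ w = List.replicate n .b ++ List.replicate n .c
  | be, w => ∃ n, 1 ≤ n ∧ w = List.replicate n .b ++ [.e]

theorem blocksGrammar_language : blocksGrammar.language = langBlocks := by
  have hmem := forall_blocksGrammar_rules.1 fun r hr => hr
  obtain ⟨hS, hSB, hSE, hB, hB1, hE, hE1⟩ := hmem
  have hbc (n : ℕ) : GenWord blocksGrammar BlocksNT.bc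
      (List.replicate (n + 1) .b ++ List.replicate (n + 1) .c) := by
    induction n with
    | zero => exact genWord_of_rule hB1 (.terminal _ (.terminal _ .nil))
    | succ n ih =>
      rw [List.replicate_succ, List.replicate_succ' (n := n + 1)]
      simpa using genWord_of_rule hB (.terminal _ (.nonterminal ih (.terminal _ .nil)))
  have hbe (n : ℕ) : GenWord blocksGrammar BlocksNT.be
      (List.replicate (n + 1) .b ++ [.e]) := by
    induction n with
    | zero => exact genWord_of_rule hE1 (.terminal _ (.terminal _ .nil))
    | succ n ih =>
      rw [List.replicate_succ]
      exact genWord_of_rule hE (.terminal _ (.singleton ih))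
  have hstart {w : List Letter} (hw : GenWord blocksGrammar BlocksNT.start
      (.a :: (w ++ [.d]))) (m : ℕ) : GenWord blocksGrammar BlocksNT.start
      (List.replicate (m + 1) .a ++ w ++ List.replicate (m + 1) .d) := by
    induction m with
    | zero => simpa using hw
    | succ m ih =>
      rw [List.replicate_succ, List.replicate_succ' (n := m + 1)]
      simpa using genWord_of_rule hS (.terminal _ (.nonterminal ih (.terminal _ .nil)))
  ext w
  constructor
  · intro h
    refine GenWord.induction (G := blocksGrammar) (P := BlocksNT.Word) (X := BlocksNT.start) ?_ h
    have key : ∀ r ∈ blocksGrammar.rules, ∀ u, Factors BlocksNT.Word r.output u →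
        BlocksNT.Word r.input u := by
      refine forall_blocksGrammar_rules.2 ⟨?_, ?_, ?_, ?_, ?_, ?_, ?_⟩ <;> intro w hw <;>
        simp only [Factors.nonterminal_iff, Factors.terminal_iff, Factors.nil_iff] at hw
      · obtain ⟨_, rfl, u, _, rfl, ⟨m, n, hm, hn, rfl | rfl⟩, _, rfl, rfl⟩ := hw
        · exact ⟨m + 1, n, by omega, hn, .inl (by
            rw [List.replicate_succ, List.replicate_succ' (a := Letter.d)]; simp)⟩
        · exact ⟨m + 1, n, by omega, hn, .inr (by
            rw [List.replicate_succ, List.replicate_succ' (a := Letter.d)]; simp)⟩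
      · obtain ⟨_, rfl, u, _, rfl, ⟨n, hn, rfl⟩, _, rfl, rfl⟩ := hw
        exact ⟨1, n, le_rfl, hn, .inl (by simp)⟩
      · obtain ⟨_, rfl, u, _, rfl, ⟨n, hn, rfl⟩, _, rfl, rfl⟩ := hw
        exact ⟨1, n, le_rfl, hn, .inr (by simp)⟩
      · obtain ⟨_, rfl, u, _, rfl, ⟨n, hn, rfl⟩, _, rfl, rfl⟩ := hw
        exact ⟨n + 1, by omega, by
          rw [List.replicate_succ, List.replicate_succ' (a := Letter.c)]; simp⟩
      · obtain ⟨_, rfl, _, rfl, rfl⟩ := hw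
        exact ⟨1, le_rfl, rfl⟩
      · obtain ⟨_, rfl, u, _, rfl, ⟨n, hn, rfl⟩, rfl⟩ := hw
        exact ⟨n + 1, by omega, by simp [List.replicate_succ]⟩
      · obtain ⟨_, rfl, _, rfl, rfl⟩ := hw
        exact ⟨1, le_rfl, rfl⟩
    exact fun r hr u hu => key r hr u (hu.mono fun _ _ h => h.2)
  · rintro ⟨m, n, hm, hn, rfl | rfl⟩ <;>
      obtain ⟨m, rfl⟩ := Nat.exists_eq_add_of_le' hm <;>
      obtain ⟨n, rfl⟩ := Nat.exists_eq_add_of_le' hn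
    · rw [List.append_assoc (List.replicate (m + 1) _)]
      exact hstart (genWord_of_rule hSB
        (.terminal _ (.nonterminal (hbc n) (.terminal _ .nil)))) m
    · rw [List.append_assoc (List.replicate (m + 1) _)]
      exact hstart (genWord_of_rule hSE
        (.terminal _ (.nonterminal (hbe n) (.terminal _ .nil)))) m

/-- Nonterminals of a grammar for `langPairs`: the axiom and one nonterminal for each of the three
parts of the language. -/
inductive PairsNT where
  | start
  | bc
  | fd
  | efb

open Symbol PairsNT in
/-- The rules of a grammar for `langPairs`. -/
def pairsRules : Set (ContextFreeRule Letter PairsNT) := {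
  ⟨start, [nonterminal bc]⟩,
  ⟨start, [nonterminal fd]⟩,
  ⟨start, [nonterminal efb]⟩,
  ⟨bc, [terminal .b, nonterminal bc, terminal .c]⟩,
  ⟨bc, [terminal .b, terminal .c]⟩,
  ⟨fd, [terminal .f, nonterminal fd, terminal .d]⟩,
  ⟨fd, [terminal .f, terminal .d]⟩,
  ⟨efb, [terminal .e, nonterminal efb, terminal .f, terminal .b]⟩,
  ⟨efb, [terminal .e, terminal .f, terminal .b]⟩}

theorem finite_pairsRules : pairsRules.Finite := by
  unfold pairsRules
  exact Set.toFinite _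

/-- A grammar for `langPairs`. -/
noncomputable def pairsGrammar : ContextFreeGrammar Letter where
  NT := PairsNT
  initial := .start
  rules := finite_pairsRules.toFinset

/-- The precedence relations of the grammar for `langPairs`. -/
def pairsTable : Letter → Letter → Option Prec
  | .b, .b => some .yields
  | .b, .c => some .equal
  | .c, .c => some .takes
  | .f, .f => some .yields
  | .f, .d => some .equal
  | .d, .d => some .takes
  | .e, .e => some .yields
  | .e, .f => some .equal
  | .f, .b => some .equal
  | .b, .f => some .takes
  | _, _ => none

/-- The left terminals in the grammar for `langPairs`. -/
def PairsNT.left : PairsNT → Set Letter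
  | start => {.b, .f, .e}
  | bc => {.b}
  | fd => {.f}
  | efb => {.e}

/-- The right terminals in the grammar for `langPairs`. -/
def PairsNT.right : PairsNT → Set Letter
  | start => {.c, .d, .b}
  | bc => {.c}
  | fd => {.d}
  | efb => {.b}

theorem forall_pairsGrammar_rules {p : ContextFreeRule Letter PairsNT → Prop} :
    (∀ r ∈ pairsGrammar.rules, p r) ↔
      p ⟨.start, [.nonterminal .bc]⟩ ∧
      p ⟨.start, [.nonterminal .fd]⟩ ∧
      p ⟨.start, [.nonterminal .efb]⟩ ∧
      p ⟨.bc, [.terminal .b, .nonterminal .bc, .terminal .c]⟩ ∧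
      p ⟨.bc, [.terminal .b, .terminal .c]⟩ ∧
      p ⟨.fd, [.terminal .f, .nonterminal .fd, .terminal .d]⟩ ∧
      p ⟨.fd, [.terminal .f, .terminal .d]⟩ ∧
      p ⟨.efb, [.terminal .e, .nonterminal .efb, .terminal .f, .terminal .b]⟩ ∧
      p ⟨.efb, [.terminal .e, .terminal .f, .terminal .b]⟩ := by
  rw [show (∀ r ∈ pairsGrammar.rules, p r) ↔ ∀ r ∈ pairsRules, p r from
    forall_congr' fun _ => imp_congr_left finite_pairsRules.mem_toFinset]
  simp [pairsRules]

theorem isOPG_pairsGrammar : IsOPG pairsGrammar := by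
  refine isOPG_of_tableMatrix (T := pairsTable)
    (opm_subset_of_respects (ℓ := PairsNT.left) (ρ := PairsNT.right)
      (forall_pairsGrammar_rules (p := fun r =>
        LeadIn PairsNT.left (PairsNT.left r.input) r.output).2 ?_)
      (forall_pairsGrammar_rules (p := fun r =>
        LeadIn PairsNT.right (PairsNT.right r.input) r.output.reverse).2 ?_)
      (forall_pairsGrammar_rules (p := fun r =>
        Respects (tableMatrix pairsTable) PairsNT.left PairsNT.right r.output).2 ?_)) <;>
  simp [LeadIn, Respects, TerminalRespects, NonterminalRespects, PairsNT.left, PairsNT.right,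
    tableMatrix, pairsTable]

/-- The words derived from a nonterminal of the grammar for `langPairs`. -/
def PairsNT.Word : PairsNT → List Letter → Prop
  | start, w => w ∈ langPairs
  | bc, w => ∃ n, 1 ≤ n ∧ w = List.replicate n .b ++ List.replicate n .c
  | fd, w => ∃ n, 1 ≤ n ∧ w = List.replicate n .f ++ List.replicate n .d
  | efb, w => ∃ n, 1 ≤ n ∧ w = List.replicate n .e ++ (List.replicate n [.f, .b]).flatten

theorem pairsGrammar_language : pairsGrammar.language = langPairs := by
  have hmem := forall_pairsGrammar_rules.1 fun r hr => hr
  obtain ⟨hSB, hSF, hSE, hB, hB1, hF, hF1, hE, hE1⟩ := hmem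
  have hbc (n : ℕ) : GenWord pairsGrammar PairsNT.bc
      (List.replicate (n + 1) .b ++ List.replicate (n + 1) .c) := by
    induction n with
    | zero => exact genWord_of_rule hB1 (.terminal _ (.terminal _ .nil))
    | succ n ih =>
      rw [List.replicate_succ, List.replicate_succ' (n := n + 1)]
      simpa using genWord_of_rule hB (.terminal _ (.nonterminal ih (.terminal _ .nil)))
  have hfd (n : ℕ) : GenWord pairsGrammar PairsNT.fd
      (List.replicate (n + 1) .f ++ List.replicate (n + 1) .d) := by
    induction n with
    | zero => exact genWord_of_rule hF1 (.terminal _ (.terminal _ .nil))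
    | succ n ih =>
      rw [List.replicate_succ, List.replicate_succ' (n := n + 1)]
      simpa using genWord_of_rule hF (.terminal _ (.nonterminal ih (.terminal _ .nil)))
  have hefb (n : ℕ) : GenWord pairsGrammar PairsNT.efb
      (List.replicate (n + 1) .e ++ (List.replicate (n + 1) [.f, .b]).flatten) := by
    induction n with
    | zero => exact genWord_of_rule hE1 (.terminal _ (.terminal _ (.terminal _ .nil)))
    | succ n ih =>
      rw [List.replicate_succ, List.replicate_succ' (n := n + 1)]
      simpa using genWord_of_rule hE
        (.terminal _ (.nonterminal ih (.terminal _ (.terminal _ .nil))))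
  ext w
  constructor
  · intro h
    refine GenWord.induction (G := pairsGrammar) (P := PairsNT.Word) (X := PairsNT.start) ?_ h
    have key : ∀ r ∈ pairsGrammar.rules, ∀ u, Factors PairsNT.Word r.output u →
        PairsNT.Word r.input u := by
      refine forall_pairsGrammar_rules.2 ⟨?_, ?_, ?_, ?_, ?_, ?_, ?_, ?_, ?_⟩ <;> intro w hw <;>
        simp only [Factors.nonterminal_iff, Factors.terminal_iff, Factors.nil_iff] at hw
      · obtain ⟨_, _, rfl, ⟨n, hn, rfl⟩, rfl⟩ := hw
        exact ⟨n, hn, .inl (by simp)⟩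
      · obtain ⟨_, _, rfl, ⟨n, hn, rfl⟩, rfl⟩ := hw
        exact ⟨n, hn, .inr (.inl (by simp))⟩
      · obtain ⟨_, _, rfl, ⟨n, hn, rfl⟩, rfl⟩ := hw
        exact ⟨n, hn, .inr (.inr (by simp))⟩
      · obtain ⟨_, rfl, u, _, rfl, ⟨n, hn, rfl⟩, _, rfl, rfl⟩ := hw
        exact ⟨n + 1, by omega, by
          rw [List.replicate_succ, List.replicate_succ' (a := Letter.c)]; simp⟩
      · obtain ⟨_, rfl, _, rfl, rfl⟩ := hw
        exact ⟨1, le_rfl, rfl⟩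
      · obtain ⟨_, rfl, u, _, rfl, ⟨n, hn, rfl⟩, _, rfl, rfl⟩ := hw
        exact ⟨n + 1, by omega, by
          rw [List.replicate_succ, List.replicate_succ' (a := Letter.d)]; simp⟩
      · obtain ⟨_, rfl, _, rfl, rfl⟩ := hw
        exact ⟨1, le_rfl, rfl⟩
      · obtain ⟨_, rfl, u, _, rfl, ⟨n, hn, rfl⟩, _, rfl, _, rfl, rfl⟩ := hw
        exact ⟨n + 1, by omega, by
          rw [List.replicate_succ, List.replicate_succ' (a := [Letter.f, Letter.b])]; simp⟩
      · obtain ⟨_, rfl, _, rfl, _, rfl, rfl⟩ := hw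
        exact ⟨1, le_rfl, rfl⟩
    exact fun r hr u hu => key r hr u (hu.mono fun _ _ h => h.2)
  · rintro ⟨n, hn, rfl | rfl | rfl⟩ <;> obtain ⟨n, rfl⟩ := Nat.exists_eq_add_of_le' hn
    · exact genWord_of_rule hSB (.singleton (hbc n))
    · exact genWord_of_rule hSF (.singleton (hfd n))
    · exact genWord_of_rule hSE (.singleton (hefb n))

end Grammars

/-! ### The language `langPairs` is not visibly pushdown -/

section NotVPL

universe u

namespace VPA

variable {A : Type u} {kind : A → Kind} {M : VPA kind}

theorem Step.exists_cons {c c' : List A × M.Q × List M.Γ} (h : M.Step c c') :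
    ∃ a, c.1 = a :: c'.1 ∧ ∀ x, M.Step (a :: x, c.2) (x, c'.2) := by
  cases h with
  | call _ s h => exact ⟨_, rfl, fun x => .call x s h⟩
  | ret _ s h hD => exact ⟨_, rfl, fun x => .ret x s h hD⟩
  | retBottom _ s h => exact ⟨_, rfl, fun x => .retBottom x s h⟩
  | internal _ s h => exact ⟨_, rfl, fun x => .internal x s h⟩

/-- A complete run splits along any factorization of the input. -/
theorem exists_run_append {w x : List A} {q q' : M.Q} {s s' : List M.Γ}
    (h : Relation.ReflTransGen M.Step (w ++ x, q, s) ([], q', s')) :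
    ∃ q₁ s₁, (∀ y, Relation.ReflTransGen M.Step (w ++ y, q, s) (y, q₁, s₁)) ∧
      Relation.ReflTransGen M.Step (x, q₁, s₁) ([], q', s') := by
  induction w generalizing q s with
  | nil => exact ⟨q, s, fun y => .refl, h⟩
  | cons a w ih =>
    obtain h | ⟨⟨y, q₂, s₂⟩, h₁, h₂⟩ := Relation.ReflTransGen.cases_head h
    · simp at h
    · obtain ⟨b, hb, hstep⟩ := h₁.exists_cons
      obtain ⟨rfl, rfl⟩ := List.cons.inj hb
      obtain ⟨q₁, s₁, h₃, h₄⟩ := ih h₂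
      exact ⟨q₁, s₁, fun y => (h₃ y).head (hstep _), h₄⟩

/-- Without calls the stack stays at its bottom. -/
theorem stack_eq_of_no_call {c c' : List A × M.Q × List M.Γ}
    (h : Relation.ReflTransGen M.Step c c') (hc : ∀ a ∈ c.1, kind a ≠ Kind.call)
    (hs : c.2.2 = [M.Z₀]) : c'.2.2 = [M.Z₀] := by
  induction h using Relation.ReflTransGen.head_induction_on with
  | refl => exact hs
  | head h _ ih =>
    cases h with
    | call x s h => exact absurd (M.call_mem _ _ _ _ h).1 (hc _ (by simp))
    | ret x s h hD => exact absurd (List.cons.inj hs).1 hD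
    | retBottom x s h => exact ih (fun a ha => hc a (by simp_all)) hs
    | internal x s h => exact ih (fun a ha => hc a (by simp_all)) hs

/-- If all letters are calls then the stack does not influence the states. -/
theorem exists_run_of_all_call {c c' : List A × M.Q × List M.Γ}
    (h : Relation.ReflTransGen M.Step c c') (hc : ∀ a ∈ c.1, kind a = Kind.call)
    (t : List M.Γ) :
    ∃ t', Relation.ReflTransGen M.Step (c.1, c.2.1, t) (c'.1, c'.2.1, t') := by
  induction h using Relation.ReflTransGen.head_induction_on generalizing t with
  | refl => exact ⟨t, .refl⟩
  | head h _ ih =>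
    cases h with
    | @call _ _ _ D x s h =>
      obtain ⟨t', ht'⟩ := ih (fun a ha => hc a (by simp_all)) (D :: t)
      exact ⟨t', ht'.head (.call x t h)⟩
    | @ret _ a _ _ x s h hD =>
      have := hc a (by simp)
      simp [M.ret_mem _ _ _ _ h] at this
    | @retBottom _ a _ x s h =>
      have := hc a (by simp)
      simp [M.ret_mem _ _ _ _ h] at this
    | @internal _ a _ x s h =>
      have := hc a (by simp)
      simp [M.int_mem _ _ _ h] at this

/-- If no call occurs in the words `u n`, or only calls occur in the words `v n`, then nothing but
the state connects `u n` to `v n`, so some `u n` can be combined with another `v m`. -/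
theorem exists_ne_append_mem_language {u v : ℕ → List A} (h : ∀ n, u n ++ v n ∈ M.language)
    (huv : (∀ n, ∀ a ∈ u n, kind a ≠ Kind.call) ∨ ∀ n, ∀ a ∈ v n, kind a = Kind.call) :
    ∃ n m, n ≠ m ∧ u n ++ v m ∈ M.language := by
  have := M.finite_Q
  have h' (n : ℕ) : ∃ q : M.Q, ∃ p ∈ M.I, ∃ s,
      (∀ y, Relation.ReflTransGen M.Step (u n ++ y, p, [M.Z₀]) (y, q, s)) ∧
      ∃ q' ∈ M.F, ∃ s', Relation.ReflTransGen M.Step (v n, q, s) ([], q', s') := by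
    obtain ⟨p, hp, q', hq', s', hrun⟩ := h n
    obtain ⟨q, s, h₁, h₂⟩ := exists_run_append hrun
    exact ⟨q, p, hp, s, h₁, q', hq', s', h₂⟩
  choose q hq using h'
  obtain ⟨n, m, hnm, hqq⟩ := Finite.exists_ne_map_eq_of_infinite q
  refine ⟨n, m, hnm, ?_⟩
  obtain ⟨p, hp, s, h₁, -⟩ := hq n
  obtain ⟨p', hp', t, h₁', q', hq', s', h₂⟩ := hq m
  rcases huv with hu | hv
  · have hs : s = [M.Z₀] := stack_eq_of_no_call (h₁ []) (by simpa using hu n) rfl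
    have ht : t = [M.Z₀] := stack_eq_of_no_call (h₁' []) (by simpa using hu m) rfl
    subst hs ht
    exact ⟨p, hp, q', hq', s', (h₁ _).trans (hqq ▸ h₂)⟩
  · obtain ⟨t', ht'⟩ := exists_run_of_all_call h₂ (hv m) s
    exact ⟨p, hp, q', hq', t', (h₁ _).trans (hqq ▸ ht')⟩

end VPA

theorem eq_of_mem_langPairs_bc {n m : ℕ}
    (h : List.replicate (n + 1) .b ++ List.replicate (m + 1) .c ∈ langPairs) : n = m := by
  classical
  obtain ⟨k, hk, h | h | h⟩ := h <;>
  · have hb := congrArg (List.count Letter.b) h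
    have hc := congrArg (List.count Letter.c) h
    simp [List.count_replicate, List.count_flatten] at hb hc
    try omega

theorem eq_of_mem_langPairs_fd {n m : ℕ}
    (h : List.replicate (n + 1) .f ++ List.replicate (m + 1) .d ∈ langPairs) : n = m := by
  classical
  obtain ⟨k, hk, h | h | h⟩ := h <;>
  · have hb := congrArg (List.count Letter.f) h
    have hc := congrArg (List.count Letter.d) h
    simp [List.count_replicate, List.count_flatten] at hb hc
    try omega

theorem eq_of_mem_langPairs_efb {n m : ℕ}
    (h : List.replicate (n + 1) .e ++ (List.replicate (m + 1) [.f, .b]).flatten ∈ langPairs) :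
    n = m := by
  classical
  obtain ⟨k, hk, h | h | h⟩ := h <;>
  · have hb := congrArg (List.count Letter.e) h
    have hc := congrArg (List.count Letter.f) h
    simp [List.count_replicate, List.count_flatten] at hb hc
    try omega

/-- The parts `bⁿ cⁿ` and `fⁿ dⁿ` force `b` and `f` to be calls, which makes it impossible to
compare the two halves of `eⁿ (f b)ⁿ`. -/
theorem not_isVPL_langPairs : ¬ IsVPL langPairs := by
  rintro ⟨kind, M, hM⟩
  have hb : kind .b = Kind.call := by
    by_contra hb
    obtain ⟨n, m, hnm, h⟩ := M.exists_ne_append_mem_language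
      (u := fun n => List.replicate (n + 1) .b) (v := fun n => List.replicate (n + 1) .c)
      (fun n => hM ▸ ⟨n + 1, by omega, .inl rfl⟩)
      (.inl fun n x hx => (List.eq_of_mem_replicate hx) ▸ hb)
    exact hnm (eq_of_mem_langPairs_bc (hM ▸ h))
  have hf : kind .f = Kind.call := by
    by_contra hf
    obtain ⟨n, m, hnm, h⟩ := M.exists_ne_append_mem_language
      (u := fun n => List.replicate (n + 1) .f) (v := fun n => List.replicate (n + 1) .d)
      (fun n => hM ▸ ⟨n + 1, by omega, .inr (.inl rfl)⟩)
      (.inl fun n x hx => (List.eq_of_mem_replicate hx) ▸ hf)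
    exact hnm (eq_of_mem_langPairs_fd (hM ▸ h))
  obtain ⟨n, m, hnm, h⟩ := M.exists_ne_append_mem_language
    (u := fun n => List.replicate (n + 1) .e)
    (v := fun n => (List.replicate (n + 1) [.f, .b]).flatten)
    (fun n => hM ▸ ⟨n + 1, by omega, .inr (.inr rfl)⟩)
    (.inr fun n x hx => by
      simp only [List.mem_flatten, List.mem_replicate] at hx
      obtain ⟨_, ⟨-, rfl⟩, hx⟩ := hx
      rcases List.mem_pair.1 hx with rfl | rfl
      exacts [hf, hb])
  exact hnm (eq_of_mem_langPairs_efb (hM ▸ h))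

end NotVPL

/-! ### The language `langPairs` is real-time -/

section RealTime

universe u

theorem PDA.Steps.head {A : Type u} {M : PDA A} {n : ℕ} {c₁ c₂ c₃ : List A × M.Q × List M.Γ}
    (h : M.Step c₁ c₂) (h' : M.Steps n c₂ c₃) : M.Steps (n + 1) c₁ c₃ := by
  induction h' with
  | zero c => exact .succ (.zero _) h
  | succ _ h' ih => exact .succ (ih h) h'

/-- States of an automaton for `langPairs`. -/
inductive PairsState where
  | init
  | readB
  | readC
  | readF
  | readD
  | readE
  | expectF
  | expectB
  | accept
  | dead

/-- Stack symbols of an automaton for `langPairs`: a bottom that is never removed, above it a unary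
counter, whose deepest symbol is marked so that the automaton notices the last pop. -/
inductive PairsSymbol where
  | bottom
  | last
  | more

open PairsState PairsSymbol in
/-- The transition function of an automaton for `langPairs`. -/
def pairsMove : PairsState → PairsSymbol → Letter → PairsState × List PairsSymbol
  | init, bottom, .b => (readB, [last, bottom])
  | init, bottom, .f => (readF, [last, bottom])
  | init, bottom, .e => (readE, [last, bottom])
  | readB, X, .b => (readB, [more, X])
  | readB, more, .c => (readC, [])
  | readB, last, .c => (accept, [])
  | readC, more, .c => (readC, [])
  | readC, last, .c => (accept, [])
  | readF, X, .f => (readF, [more, X])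
  | readF, more, .d => (readD, [])
  | readF, last, .d => (accept, [])
  | readD, more, .d => (readD, [])
  | readD, last, .d => (accept, [])
  | readE, X, .e => (readE, [more, X])
  | readE, X, .f => (expectB, [X])
  | expectB, more, .b => (expectF, [])
  | expectB, last, .b => (accept, [])
  | expectF, X, .f => (expectB, [X])
  | _, X, _ => (dead, [X])

instance : Finite PairsState := by
  refine Set.finite_univ_iff.1 (Set.Finite.subset (Set.toFinite
    {.init, .readB, .readC, .readF, .readD, .readE, .expectF, .expectB, .accept, .dead}) ?_)
  rintro (_ | _) - <;> simp

instance : Finite PairsSymbol := by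
  refine Set.finite_univ_iff.1 (Set.Finite.subset (Set.toFinite {.bottom, .last, .more}) ?_)
  rintro (_ | _) - <;> simp

instance : Finite Letter := by
  refine Set.finite_univ_iff.1 (Set.Finite.subset (Set.toFinite {.a, .b, .c, .d, .e, .f}) ?_)
  rintro (_ | _) - <;> simp

/-- A real-time deterministic pushdown automaton for `langPairs`. -/
def pairsPDA : PDA Letter where
  Q := PairsState
  Γ := PairsSymbol
  finite_Q := inferInstance
  finite_Γ := inferInstance
  δ := Set.range fun x : PairsState × PairsSymbol × Letter =>
    (x.1, x.2.1, some x.2.2, pairsMove x.1 x.2.1 x.2.2)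
  finite_δ := Set.finite_range _
  I := {.init}
  Z₀ := .bottom
  F := {.accept}

/-- One move on configurations; the empty stack, which never occurs, is left alone. -/
def pairsNext : PairsState × List PairsSymbol → Letter → PairsState × List PairsSymbol
  | (q, []), _ => (q, [])
  | (q, C :: s), x => ((pairsMove q C x).1, (pairsMove q C x).2 ++ s)

theorem mem_pairsPDA_δ {q q' : PairsState} {C : PairsSymbol} {o : Option Letter}
    {α : List PairsSymbol} :
    (q, C, o, q', α) ∈ pairsPDA.δ ↔ ∃ x, o = some x ∧ pairsMove q C x = (q', α) := by
  constructor
  · rintro ⟨⟨q, C, x⟩, h⟩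
    simp only [Prod.mk.injEq] at h
    obtain ⟨rfl, rfl, rfl, h⟩ := h
    exact ⟨x, rfl, h⟩
  · rintro ⟨x, rfl, h⟩
    exact ⟨(q, C, x), by rw [← h]⟩

theorem pairsNext_cons {q q' : PairsState} {C : PairsSymbol} {x : Letter} {α : List PairsSymbol}
    (h : pairsMove q C x = (q', α)) (s : List PairsSymbol) :
    pairsNext (q, C :: s) x = (q', α ++ s) := by
  simp only [pairsNext, h]

theorem foldl_pairsNext_concat (c : PairsState × List PairsSymbol) (u : List Letter) (x : Letter) :
    pairsNext (u.foldl pairsNext c) x = (u ++ [x]).foldl pairsNext c := by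
  simp

theorem bottom_mem_pairsNext {c : PairsState × List PairsSymbol} (h : .bottom ∈ c.2) (x : Letter) :
    .bottom ∈ (pairsNext c x).2 := by
  have hmove (q : PairsState) : .bottom ∈ (pairsMove q .bottom x).2 := by
    cases q <;> cases x <;> simp [pairsMove]
  match c, h with
  | (q, C :: s), h =>
    rcases List.mem_cons.1 h with rfl | h
    · exact List.mem_append_left _ (hmove q)
    · exact List.mem_append_right _ h

theorem pairsPDA_steps {c : PairsState × List PairsSymbol} (h : .bottom ∈ c.2) (w : List Letter) :
    pairsPDA.Steps w.length (w, c) ([], w.foldl pairsNext c) := by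
  induction w generalizing c with
  | nil => exact .zero _
  | cons x w ih =>
    match c, h with
    | (q, C :: s), h =>
      exact (ih (bottom_mem_pairsNext h x)).head
        (.read (M := pairsPDA) w s (mem_pairsPDA_δ.2 ⟨x, rfl, rfl⟩))

theorem pairsPDA_steps_inv {n : ℕ}
    {c c' : List Letter × pairsPDA.Q × List pairsPDA.Γ}
    (h : pairsPDA.Steps n c c') :
    ∃ u, c.1 = u ++ c'.1 ∧ u.length = n ∧ c'.2 = u.foldl pairsNext c.2 := by
  induction h with
  | zero c => exact ⟨[], rfl, rfl, rfl⟩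
  | succ _ h ih =>
    obtain ⟨u, hu, rfl, hc⟩ := ih
    cases h with
    | @read q C x q' α y s h =>
      obtain ⟨_, hx, hmove⟩ := mem_pairsPDA_δ.1 h
      cases hx
      exact ⟨u ++ [x], by simpa using hu, by simp, ((pairsNext_cons hmove s).symm.trans
        (congrArg (pairsNext · x) hc)).trans (foldl_pairsNext_concat _ u x)⟩
    | eps x s h =>
      obtain ⟨y, hy, -⟩ := mem_pairsPDA_δ.1 h
      cases hy

theorem pairsPDA_isDeterministic : pairsPDA.IsDeterministic := by
  refine ⟨⟨.init, rfl⟩, fun q C o q₁ α₁ q₂ α₂ h₁ h₂ => ?_, fun q C x q₁ α₁ q₂ α₂ _ h => ?_⟩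
  · obtain ⟨x, hx, hmove₁⟩ := mem_pairsPDA_δ.1 h₁
    obtain ⟨y, hy, hmove₂⟩ := mem_pairsPDA_δ.1 h₂
    obtain rfl : x = y := Option.some_injective _ (hx.symm.trans hy)
    exact Prod.mk.inj (hmove₁.symm.trans hmove₂)
  · obtain ⟨y, hy, -⟩ := mem_pairsPDA_δ.1 h
    cases hy

theorem pairsPDA_isRealTime : pairsPDA.IsRealTime := by
  rintro x _ rfl
  refine ⟨⟨_, pairsPDA_steps (c := (.init, [.bottom])) (by simp) x⟩, fun n c h => ?_⟩
  obtain ⟨u, hu, rfl, -⟩ := pairsPDA_steps_inv h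
  have := congrArg List.length hu
  simp at this
  omega

theorem mem_pairsPDA_language {w : List Letter} :
    w ∈ pairsPDA.language ↔ (w.foldl pairsNext (.init, [.bottom])).1 = .accept := by
  constructor
  · rintro ⟨_, rfl, _, rfl, s, n, h⟩
    obtain ⟨u, hu, rfl, hc⟩ := pairsPDA_steps_inv h
    obtain rfl : w = u := by simpa using hu
    exact (congrArg Prod.fst hc).symm
  · intro h
    exact ⟨_, rfl, _, h, _, _, pairsPDA_steps (c := (.init, [.bottom])) (by simp) w⟩

/-- Invariant of the automaton for `langPairs`: what has been read in each configuration. -/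
inductive PairsInvariant : List Letter → PairsState × List PairsSymbol → Prop
  | init : PairsInvariant [] (.init, [.bottom])
  | readB (n) : PairsInvariant (List.replicate (n + 1) .b)
      (.readB, List.replicate n .more ++ [.last, .bottom])
  | readC (n k) : PairsInvariant (List.replicate (n + 1 + k) .b ++ List.replicate k .c)
      (.readC, List.replicate n .more ++ [.last, .bottom])
  | readF (n) : PairsInvariant (List.replicate (n + 1) .f)
      (.readF, List.replicate n .more ++ [.last, .bottom])
  | readD (n k) : PairsInvariant (List.replicate (n + 1 + k) .f ++ List.replicate k .d)
      (.readD, List.replicate n .more ++ [.last, .bottom])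
  | readE (n) : PairsInvariant (List.replicate (n + 1) .e)
      (.readE, List.replicate n .more ++ [.last, .bottom])
  | expectF (n k) :
      PairsInvariant (List.replicate (n + 1 + k) .e ++ (List.replicate k [.f, .b]).flatten)
      (.expectF, List.replicate n .more ++ [.last, .bottom])
  | expectB (n k) :
      PairsInvariant (List.replicate (n + 1 + k) .e ++ (List.replicate k [.f, .b]).flatten ++ [.f])
      (.expectB, List.replicate n .more ++ [.last, .bottom])
  | accept {w} (h : w ∈ langPairs) : PairsInvariant w (.accept, [.bottom])
  | dead (w s) : PairsInvariant w (.dead, s)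

theorem exists_counter_eq_cons (n : ℕ) : ∃ C s,
    List.replicate n PairsSymbol.more ++ [.last, .bottom] = C :: s := by
  cases n with
  | zero => exact ⟨_, _, rfl⟩
  | succ n => exact ⟨_, _, rfl⟩

theorem PairsInvariant.step {w : List Letter} {c : PairsState × List PairsSymbol}
    (h : PairsInvariant w c) (x : Letter) : PairsInvariant (w ++ [x]) (pairsNext c x) := by
  cases h with
  | init =>
    cases x with
    | b => exact .readB 0
    | f => exact .readF 0
    | e => exact .readE 0
    | _ => exact .dead _ _
  | readB n =>
    cases x with
    | b =>
      have := PairsInvariant.readB (n + 1)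
      obtain ⟨C, s, hC⟩ := exists_counter_eq_cons n
      rw [List.replicate_succ', List.replicate_succ (a := PairsSymbol.more), List.cons_append,
        hC] at this
      rwa [hC]
    | c =>
      cases n with
      | zero => exact .accept ⟨1, le_rfl, .inl rfl⟩
      | succ n => exact .readC n 1
    | _ => cases n <;> exact .dead _ _
  | readC n k =>
    cases x with
    | c =>
      have h' : List.replicate k Letter.c ++ [.c] = List.replicate (k + 1) .c :=
        List.replicate_succ'.symm
      rw [List.append_assoc, h']
      cases n with
      | zero => exact .accept ⟨k + 1, by omega, .inl (by rw [zero_add, add_comm 1])⟩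
      | succ n =>
        have := PairsInvariant.readC n (k + 1)
        rwa [← add_assoc, add_right_comm _ k 1] at this
    | _ => cases n <;> exact .dead _ _
  | readF n =>
    cases x with
    | f =>
      have := PairsInvariant.readF (n + 1)
      obtain ⟨C, s, hC⟩ := exists_counter_eq_cons n
      rw [List.replicate_succ', List.replicate_succ (a := PairsSymbol.more), List.cons_append,
        hC] at this
      rwa [hC]
    | d =>
      cases n with
      | zero => exact .accept ⟨1, le_rfl, .inr (.inl rfl)⟩
      | succ n => exact .readD n 1
    | _ => cases n <;> exact .dead _ _
  | readD n k =>
    cases x with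
    | d =>
      have h' : List.replicate k Letter.d ++ [.d] = List.replicate (k + 1) .d :=
        List.replicate_succ'.symm
      rw [List.append_assoc, h']
      cases n with
      | zero => exact .accept ⟨k + 1, by omega, .inr (.inl (by rw [zero_add, add_comm 1]))⟩
      | succ n =>
        have := PairsInvariant.readD n (k + 1)
        rwa [← add_assoc, add_right_comm _ k 1] at this
    | _ => cases n <;> exact .dead _ _
  | readE n =>
    cases x with
    | e =>
      have := PairsInvariant.readE (n + 1)
      obtain ⟨C, s, hC⟩ := exists_counter_eq_cons n
      rw [List.replicate_succ', List.replicate_succ (a := PairsSymbol.more), List.cons_append,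
        hC] at this
      rwa [hC]
    | f =>
      have := PairsInvariant.expectB n 0
      simp only [List.replicate_zero, List.flatten_nil, List.append_nil, add_zero] at this
      obtain ⟨C, s, hC⟩ := exists_counter_eq_cons n
      rw [hC] at this ⊢
      exact this
    | _ => cases n <;> exact .dead _ _
  | expectF n k =>
    cases x with
    | f =>
      have := PairsInvariant.expectB n k
      obtain ⟨C, s, hC⟩ := exists_counter_eq_cons n
      rw [hC] at this ⊢
      exact this
    | _ => cases n <;> exact .dead _ _
  | expectB n k =>
    cases x with
    | b =>
      have h' : (List.replicate k [Letter.f, .b]).flatten ++ [.f] ++ [.b] =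
          (List.replicate (k + 1) [Letter.f, .b]).flatten := by
        simp [List.replicate_succ']
      rw [List.append_assoc, List.append_assoc, ← List.append_assoc (List.flatten _), h']
      cases n with
      | zero => exact .accept ⟨k + 1, by omega, .inr (.inr (by rw [zero_add, add_comm 1]))⟩
      | succ n =>
        have := PairsInvariant.expectF n (k + 1)
        rwa [← add_assoc, add_right_comm _ k 1] at this
    | _ => cases n <;> exact .dead _ _
  | accept h => cases x <;> exact .dead _ _
  | dead w s => cases s <;> cases x <;> exact .dead _ _

theorem foldl_pairsNext_push {q : PairsState} {x : Letter}
    (h : ∀ C, pairsMove q C x = (q, [.more, C])) (C : PairsSymbol) (s : List PairsSymbol) (n : ℕ) :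
    (List.replicate n x).foldl pairsNext (q, C :: s) =
      (q, List.replicate n .more ++ C :: s) := by
  induction n with
  | zero => rfl
  | succ n ih =>
    rw [List.replicate_succ', List.foldl_append, ih]
    cases n <;> simp [pairsNext, h, List.replicate_succ]

theorem foldl_pairsNext_pop {q q' : PairsState} {u : List Letter}
    (hmore : ∀ s, u.foldl pairsNext (q, .more :: s) = (q', s))
    (hmore' : ∀ s, u.foldl pairsNext (q', .more :: s) = (q', s))
    (hlast : ∀ s, u.foldl pairsNext (q, .last :: s) = (.accept, s))
    (hlast' : ∀ s, u.foldl pairsNext (q', .last :: s) = (.accept, s))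
    (s : List PairsSymbol) (n : ℕ) :
    (List.replicate (n + 1) u).flatten.foldl pairsNext
      (q, List.replicate n .more ++ .last :: s) = (.accept, s) := by
  have h (n : ℕ) : (List.replicate (n + 1) u).flatten.foldl pairsNext
      (q', List.replicate n .more ++ .last :: s) = (.accept, s) := by
    induction n with
    | zero => simpa using hlast' s
    | succ n ih =>
      rw [List.replicate_succ (a := u), List.flatten_cons, List.foldl_append, List.replicate_succ,
        List.cons_append, hmore', ih]
  cases n with
  | zero => simpa using hlast s
  | succ n =>
    rw [List.replicate_succ (a := u), List.flatten_cons, List.foldl_append, List.replicate_succ,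
      List.cons_append, hmore, h]

theorem flatten_replicate_singleton {α : Type*} (n : ℕ) (x : α) :
    (List.replicate n [x]).flatten = List.replicate n x := by
  induction n with
  | zero => rfl
  | succ n ih => simp [List.replicate_succ, ih]

theorem isRealTimeLanguage_langPairs : IsRealTimeLanguage langPairs := by
  refine ⟨pairsPDA, pairsPDA_isDeterministic, pairsPDA_isRealTime, ?_⟩
  ext w
  rw [mem_pairsPDA_language]
  constructor
  · intro h
    have hinv (w : List Letter) :
        PairsInvariant w (w.foldl pairsNext (.init, [.bottom])) := by
      induction w using List.reverseRecOn with
      | nil => exact .init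
      | append_singleton w x ih => rw [List.foldl_append]; exact ih.step x
    generalize hc : w.foldl pairsNext (.init, [.bottom]) = c at h
    have := hc ▸ hinv w
    cases this with
    | accept h' => exact h'
    | _ => simp at h
  · rintro ⟨n, hn, rfl | rfl | rfl⟩ <;> obtain ⟨n, rfl⟩ := Nat.exists_eq_add_of_le' hn <;>
      rw [List.foldl_append, List.replicate_succ, List.foldl_cons]
    · rw [← flatten_replicate_singleton (n + 1) Letter.c]
      change (List.foldl pairsNext (List.foldl pairsNext (.readB, .last :: [.bottom]) _) _).1 = _
      rw [foldl_pairsNext_push (fun C => by cases C <;> rfl),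
        foldl_pairsNext_pop (q' := .readC) (fun _ => rfl) (fun _ => rfl) (fun _ => rfl)
          (fun _ => rfl)]
    · rw [← flatten_replicate_singleton (n + 1) Letter.d]
      change (List.foldl pairsNext (List.foldl pairsNext (.readF, .last :: [.bottom]) _) _).1 = _
      rw [foldl_pairsNext_push (fun C => by cases C <;> rfl),
        foldl_pairsNext_pop (q' := .readD) (fun _ => rfl) (fun _ => rfl) (fun _ => rfl)
          (fun _ => rfl)]
    · change (List.foldl pairsNext (List.foldl pairsNext (.readE, .last :: [.bottom]) _) _).1 = _
      rw [foldl_pairsNext_push (fun C => by cases C <;> rfl),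
        foldl_pairsNext_pop (q' := .expectF) (fun _ => rfl) (fun _ => rfl) (fun _ => rfl)
          (fun _ => rfl)]

end RealTime

/-! ### The language `langBlocks` is not real-time -/

section NotRealTime

universe u

namespace PDA

variable {A : Type u} {M : PDA A}

/-- `M.Reads w c d`: by reading moves only, one for each letter of `w`, the automaton passes from
state and stack `c` to state and stack `d`. -/
inductive Reads (M : PDA A) : List A → M.Q × List M.Γ → M.Q × List M.Γ → Prop
  | nil (c) : Reads M [] c c
  | cons {q C a q' α w s c} (h : (q, C, some a, q', α) ∈ M.δ) (h' : Reads M w (q', α ++ s) c) :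
      Reads M (a :: w) (q, C :: s) c

theorem Reads.append {u v : List A} {c d e : M.Q × List M.Γ} (h : M.Reads u c d)
    (h' : M.Reads v d e) : M.Reads (u ++ v) c e := by
  induction h with
  | nil => exact h'
  | cons h _ ih => exact .cons h (ih h')

theorem Reads.exists_append {u v : List A} {c e : M.Q × List M.Γ} (h : M.Reads (u ++ v) c e) :
    ∃ d, M.Reads u c d ∧ M.Reads v d e := by
  induction u generalizing c with
  | nil => exact ⟨c, .nil c, h⟩
  | cons a u ih =>
    cases h with
    | cons hδ h =>
      obtain ⟨d, h₁, h₂⟩ := ih h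
      exact ⟨d, .cons hδ h₁, h₂⟩

theorem Reads.unique (hM : M.IsDeterministic) {w : List A} {c d d' : M.Q × List M.Γ}
    (h : M.Reads w c d) (h' : M.Reads w c d') : d = d' := by
  induction h with
  | nil => cases h'; rfl
  | cons hδ _ ih =>
    cases h' with
    | cons hδ' h' =>
      obtain ⟨rfl, rfl⟩ := hM.2.1 _ _ _ _ _ _ _ hδ hδ'
      exact ih h'

/-- Symbols added below the stack do not matter. -/
theorem Reads.append_stack {w : List A} {c d : M.Q × List M.Γ} (h : M.Reads w c d)
    (s : List M.Γ) : M.Reads w (c.1, c.2 ++ s) (d.1, d.2 ++ s) := by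
  induction h with
  | nil => exact .nil _
  | cons hδ _ ih => exact .cons hδ (by simpa using ih)

/-- Since every move removes at most one symbol, reading `w` depends only on the topmost `|w|`
stack symbols. -/
theorem Reads.exists_of_length_le {w : List A} {q : M.Q} {σ s : List M.Γ}
    {d : M.Q × List M.Γ} (h : M.Reads w (q, σ ++ s) d) (hσ : w.length ≤ σ.length) :
    ∃ τ, d.2 = τ ++ s ∧ M.Reads w (q, σ) (d.1, τ) := by
  induction w generalizing q σ with
  | nil => cases h; exact ⟨σ, rfl, .nil _⟩
  | cons a w ih =>
    match σ, hσ with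
    | C :: σ, hσ =>
      cases h with
      | @cons _ _ _ p α _ _ _ hδ h =>
        have h : M.Reads w (p, (α ++ σ) ++ s) d := by rw [List.append_assoc]; exact h
        obtain ⟨τ, hτ, h⟩ := ih h (by simp at hσ ⊢; omega)
        exact ⟨τ, hτ, .cons hδ h⟩

theorem Reads.steps {w : List A} {c d : M.Q × List M.Γ} (h : M.Reads w c d) :
    M.Steps w.length (w, c) ([], d) := by
  induction h with
  | nil => exact .zero _
  | cons hδ _ ih => exact ih.head (.read _ _ hδ)

theorem Steps.length_le {n : ℕ} {c d : List A × M.Q × List M.Γ} (h : M.Steps n c d) :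
    c.1.length ≤ n + d.1.length := by
  induction h with
  | zero => simp
  | succ _ h ih => cases h <;> simp_all <;> omega

/-- A computation with at most one move per letter consists of reading moves. -/
theorem Steps.exists_reads {n : ℕ} {c d : List A × M.Q × List M.Γ} (h : M.Steps n c d)
    (hn : n + d.1.length ≤ c.1.length) : ∃ u, c.1 = u ++ d.1 ∧ M.Reads u c.2 d.2 := by
  induction h with
  | zero => exact ⟨[], rfl, .nil _⟩
  | succ h h' ih =>
    cases h' with
    | read x s hδ =>
      obtain ⟨u, hu, hr⟩ := ih (by simp at hn ⊢; omega)
      exact ⟨u ++ [_], by simpa using hu, hr.append (.cons hδ (.nil _))⟩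
    | eps x s hδ =>
      have := h.length_le
      simp at hn this
      omega

theorem IsRealTime.mem_language_iff (hM : M.IsRealTime) {q₀ : M.Q} (hq₀ : M.I = {q₀})
    {w : List A} : w ∈ M.language ↔ ∃ c, c.1 ∈ M.F ∧ M.Reads w (q₀, [M.Z₀]) c := by
  constructor
  · rintro ⟨q, hq, q', hq', s, n, h⟩
    obtain rfl : q = q₀ := by simpa [hq₀] using hq
    obtain ⟨u, hu, hr⟩ := h.exists_reads ((hM w q hq).2 n _ h)
    obtain rfl : w = u := by simpa using hu
    exact ⟨_, hq', hr⟩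
  · rintro ⟨c, hc, h⟩
    exact ⟨q₀, by simp [hq₀], c.1, hc, c.2, _, h.steps⟩

end PDA

/-- Infinitely many configurations cannot all have small stacks. -/
theorem exists_le_length_of_injective {Q Γ : Type} [Finite Q] [Finite Γ] {c : ℕ → Q × List Γ}
    (hc : Function.Injective c) (h : ℕ) : ∃ j, h ≤ (c j).2.length := by
  by_contra! hlt
  have hfin : ((Set.univ : Set Q) ×ˢ {s : List Γ | s.length ≤ h}).Finite :=
    Set.finite_univ.prod (List.finite_length_le Γ h)
  exact Set.infinite_range_of_injective hc
    (hfin.subset (by rintro _ ⟨j, rfl⟩; exact ⟨trivial, (hlt j).le⟩))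

/-- From the moment at which the stack is lowest, a computation only works above the symbols that
lie below the top at that moment. -/
theorem PDA.exists_lowest {A : Type u} (M : PDA A) {b : A} {c : ℕ → M.Q × List M.Γ}
    (hc : ∀ n, M.Reads [b] (c n) (c (n + 1))) :
    ∃ (t : ℕ) (q : M.Q) (C : M.Γ) (s : List M.Γ) (d : ℕ → M.Q × List M.Γ), ∀ j,
      M.Reads (List.replicate j b) (q, [C]) (d j) ∧ c (t + j) = ((d j).1, (d j).2 ++ s) := by
  let t := Function.argmin fun n => (c n).2.length
  have ht (n : ℕ) : (c t).2.length ≤ (c n).2.length :=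
    Function.argmin_le (fun n => (c n).2.length) n
  obtain ⟨q, C, s, hct⟩ : ∃ q C s, c t = (q, C :: s) := by
    have h (e e' : M.Q × List M.Γ) (h : M.Reads [b] e e') : ∃ q C s, e = (q, C :: s) := by
      cases h
      exact ⟨_, _, _, rfl⟩
    exact h _ _ (hc t)
  have key (j : ℕ) : ∃ d, M.Reads (List.replicate j b) (q, [C]) d ∧
      c (t + j) = (d.1, d.2 ++ s) := by
    induction j with
    | zero => exact ⟨(q, [C]), .nil _, hct⟩
    | succ j ih =>
      obtain ⟨d, hd, hcd⟩ := ih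
      have hlen := ht (t + j)
      rw [hct, hcd] at hlen
      have hstep := hc (t + j)
      rw [hcd] at hstep
      obtain ⟨τ, hτ, h⟩ := hstep.exists_of_length_le (by simp at hlen ⊢; omega)
      refine ⟨((c (t + j + 1)).1, τ), ?_, ?_⟩
      · rw [List.replicate_succ']
        exact hd.append h
      · rw [← hτ]; rfl
  choose d hd using key
  exact ⟨t, q, C, s, d, hd⟩

theorem eq_of_mem_langBlocks_bc {m n k : ℕ} (h : List.replicate (m + 1) .a ++
    List.replicate (n + 1) .b ++ (List.replicate (k + 1) .c ++ List.replicate (m + 1) .d) ∈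
      langBlocks) : n = k := by
  classical
  obtain ⟨m', n', -, -, h | h⟩ := h <;>
  · have hb := congrArg (List.count Letter.b) h
    have hc := congrArg (List.count Letter.c) h
    simp [List.count_replicate] at hb hc
    try omega

theorem eq_of_mem_langBlocks_e {m n k : ℕ} (h : List.replicate (m + 1) .a ++
    List.replicate (n + 1) .b ++ (.e :: List.replicate (k + 1) .d) ∈ langBlocks) : m = k := by
  classical
  obtain ⟨m', n', -, -, h | h⟩ := h <;>
  · have ha := congrArg (List.count Letter.a) h
    have hd := congrArg (List.count Letter.d) h
    simp [List.count_replicate] at ha hd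
    omega

/-- For every `m` the stack grows without bound while `b`s are read after `aᵐ`, and from its lowest
point on the upper part of the stack is determined by a state and a stack symbol. Two values of `m`
share these, and then the answer to `e dᵐ`, which depends on the upper part only, is the same. -/
theorem not_isRealTimeLanguage_langBlocks : ¬ IsRealTimeLanguage langBlocks := by
  rintro ⟨M, hdet, hreal, hL⟩
  have := M.finite_Q
  have := M.finite_Γ
  obtain ⟨q₀, hq₀⟩ := hdet.1
  have hmem (w : List Letter) :
      w ∈ langBlocks ↔ ∃ c, c.1 ∈ M.F ∧ M.Reads w (q₀, [M.Z₀]) c := by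
    rw [← hL, hreal.mem_language_iff hq₀]
  have he (m n : ℕ) : List.replicate (m + 1) .a ++ List.replicate (n + 1) .b ++
      (.e :: List.replicate (m + 1) .d) ∈ langBlocks :=
    ⟨m + 1, n + 1, by omega, by omega, .inr (by simp)⟩
  have hcd (m n : ℕ) : List.replicate (m + 1) .a ++ List.replicate (n + 1) .b ++
      (List.replicate (n + 1) .c ++ List.replicate (m + 1) .d) ∈ langBlocks :=
    ⟨m + 1, n + 1, by omega, by omega, .inl (by simp)⟩
  have hex (m n : ℕ) : ∃ c, M.Reads (List.replicate (m + 1) .a ++ List.replicate (n + 1) .b)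
      (q₀, [M.Z₀]) c := by
    obtain ⟨c, -, hc⟩ := (hmem _).1 (he m n)
    obtain ⟨d, hd, -⟩ := hc.exists_append
    exact ⟨d, hd⟩
  choose c hc using hex
  have hstep (m n : ℕ) : M.Reads [.b] (c m n) (c m (n + 1)) := by
    have h := hc m (n + 1)
    rw [List.replicate_succ' (a := Letter.b), ← List.append_assoc] at h
    obtain ⟨d, hd, h⟩ := h.exists_append
    rwa [(hc m n).unique hdet hd]
  -- The continuation of an accepted word is read from the chosen configuration.
  have hcont {m n : ℕ} {v : List Letter} : List.replicate (m + 1) .a ++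
      List.replicate (n + 1) .b ++ v ∈ langBlocks ↔ ∃ f, f.1 ∈ M.F ∧ M.Reads v (c m n) f := by
    rw [hmem]
    constructor
    · rintro ⟨f, hf, h⟩
      obtain ⟨d, hd, h⟩ := h.exists_append
      exact ⟨f, hf, (hc m n).unique hdet hd ▸ h⟩
    · rintro ⟨f, hf, h⟩
      exact ⟨f, hf, (hc m n).append h⟩
  have hinj (m : ℕ) : Function.Injective (c m) := by
    intro n n' h
    have := hcont.1 (hcd m n)
    rw [h] at this
    exact (eq_of_mem_langBlocks_bc (hcont.2 this)).symm
  choose t q C s d hd using fun m => M.exists_lowest (hstep m)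
  obtain ⟨m, m', hne, heq⟩ := Finite.exists_ne_map_eq_of_infinite fun m => (q m, C m)
  obtain ⟨hq, hC⟩ := Prod.mk.inj heq
  have hdd (j : ℕ) : d m j = d m' j := by
    have h := (hd m j).1
    rw [hq, hC] at h
    exact h.unique hdet (hd m' j).1
  have hdinj : Function.Injective (d m) := by
    intro j j' h
    have := hinj m (((hd m j).2.trans (by rw [h])).trans (hd m j').2.symm)
    omega
  -- The word `e dᵐ⁺¹` has length `m + 2`.
  obtain ⟨j, hj⟩ := exists_le_length_of_injective hdinj (m + 2)
  obtain ⟨f, hf, h⟩ := hcont.1 (he m (t m + j))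
  rw [(hd m j).2] at h
  obtain ⟨τ, -, h⟩ := h.exists_of_length_le (by simp; omega)
  have h' := h.append_stack (s m')
  rw [hdd j, ← (hd m' j).2] at h'
  exact hne (eq_of_mem_langBlocks_e (hcont.2 ⟨(f.1, τ ++ s m'), hf, h'⟩)).symm

end NotRealTime

/-! ### Visibly pushdown languages and partitioned matrices -/

universe u

theorem exists_opg_of_isVPLOver {A : Type u} [Finite A] {kind : A → Kind} {L : Language A}
    (h : IsVPLOver kind L) :
    ∃ G : ContextFreeGrammar A, IsOPG G ∧ opm G = partitionedMatrix kind ∧ G.language = L := by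
  obtain ⟨M, rfl⟩ := h
  obtain ⟨hop, hM⟩ := vpaGrammar_opm_subset M
  exact ⟨vpaGrammar M, isOPG_of_subset_partitionedMatrix hop hM, vpaGrammar_opm_eq M,
    vpaGrammar_language M⟩

theorem isVPLOver_of_opm_subset {A : Type u} [Finite A] {kind : A → Kind}
    {G : ContextFreeGrammar A} (hG : IsOPG G)
    (hM : ∀ a b, opm G a b ⊆ partitionedMatrix kind a b) : IsVPLOver kind G.language :=
  ⟨parser G kind, parser_language hG.1 hM⟩

end StructLang

theorem mainTheorem1 :
    -- for a fixed partition: VPL = OPL whose matrix is (equivalently, is contained in) the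
    -- partitioned matrix
    (∀ (A : Type*) [Finite A] (kind : A → Kind) (L : Language A),
      (IsVPLOver kind L ↔
        ∃ G : ContextFreeGrammar A,
          IsOPG G ∧ opm G = partitionedMatrix kind ∧ G.language = L) ∧
      (IsVPLOver kind L ↔
        ∃ G : ContextFreeGrammar A,
          IsOPG G ∧ (∀ a b, opm G a b ⊆ partitionedMatrix kind a b) ∧ G.language = L)) ∧
    -- VPL are included in OPL
    (∀ (A : Type*) [Finite A] (L : Language A), IsVPL L → IsOPL L) ∧
    -- an OPL that is not real-time
    (IsOPL langBlocks ∧ ¬ IsRealTimeLanguage langBlocks) ∧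
    -- a real-time OPL that is not a VPL, whatever the partition of the alphabet
    (IsOPL langPairs ∧ IsRealTimeLanguage langPairs ∧ ¬ IsVPL langPairs) := by
  have hopl (A : Type _) [Finite A] (L : Language A) (h : IsVPL L) : IsOPL L := by
    obtain ⟨kind, h⟩ := h
    obtain ⟨G, hG, -, hL⟩ := exists_opg_of_isVPLOver h
    exact ⟨G, hG, hL⟩
  refine ⟨fun A _ kind L => ⟨⟨exists_opg_of_isVPLOver, ?_⟩, fun h => ?_, ?_⟩, hopl,
    ⟨⟨_, isOPG_blocksGrammar, blocksGrammar_language⟩, not_isRealTimeLanguage_langBlocks⟩,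
    ⟨_, isOPG_pairsGrammar, pairsGrammar_language⟩, isRealTimeLanguage_langPairs,
    not_isVPL_langPairs⟩
  · rintro ⟨G, hG, hM, rfl⟩
    exact isVPLOver_of_opm_subset hG fun a b => (congrFun₂ hM a b).le
  · obtain ⟨G, hG, hM, hL⟩ := exists_opg_of_isVPLOver h
    exact ⟨G, hG, fun a b => (congrFun₂ hM a b).le, hL⟩
  · rintro ⟨G, hG, hM, rfl⟩
    exact isVPLOver_of_opm_subset hG hM
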